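/- Let $k$ be a field of characteristic different from $2$ and $3$, let $a,d\in k$ be distinct and non-zero, and let $E$ be the twisted Edwards curve $ax^2+y^2=1+dx^2y^2$. In the function field $\overline{k}(E)$ define \begin{align*} \psi_0&=0,\qquad \psi_1=1,\qquad \psi_2=\frac{(a-d)(1+y)}{x\,(2(1-y))},\\ \psi_3&=\frac{(a-d)^3(a+2ay-2dy^3-dy^4)}{(2(1-y))^4},\qquad \psi_4=\frac{2(a-d)^6\,y(1+y)(a-dy^4)}{x\,(2(1-y))^7},\\ \psi_{2m+1}&=\psi_{m+2}\psi_m^3-\psi_{m-1}\psi_{m+1}^3\quad(m\ge 2),\\ \psi_{2m}&=\frac{\psi_m}{\psi_2}\left(\psi_{m+2}\psi_{m-1}^2-\psi_{m-2}\psi_{m+1}^2\right)\quad(m\ge 3), \end{align*} and, for $n\ge 1$, \[ \phi_n=\frac{(1+y)\psi_n^2}{1-y}-\frac{4\psi_{n-1}\psi_{n+1}}{a-d},\qquad \omega_n=\frac{2\psi_{2n}}{(a-d)\psi_n}. \] Addition on $E$ is given by the Edwards rule \[ (x_1,y_1)+(x_2,y_2)=\left(\frac{x_1y_2+x_2y_1}{1+dx_1x_2y_1y_2},\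 \frac{y_1y_2-ax_1x_2}{1-dx_1x_2y_1y_2}\right), \] with identity $(0,1)$. Since the denominators may vanish over $\overline{k}$, it is taken on the completion $\{((X:Z),(Y:T)) : aX^2T^2+Y^2Z^2=Z^2T^2+dX^2Y^2\}\subset\mathbb{P}^1\times\mathbb{P}^1$ of $E$, where the rule is applied in homogeneous form and, wherever numerator and denominator of one of its two coordinates both vanish, is replaced by the homogeneous form of the rule \[ \left(\frac{x_1y_1+x_2y_2}{ax_1x_2+y_1y_2},\ \frac{x_1y_1-x_2y_2}{x_1y_2-x_2y_1}\right), \] which defines the same rational map. Write $[n]P=P+\dots+P$ ($n$ summands). Let $(x,y)\in E(\overline{k})\setminus\{(0,1),(0,-1)\}$ and let $n\ge 1$ be an integer. Then $\psi_n,\phi_n,\omega_n$ are regular at $(x,y)$, the functions $\omega_n$ and $\phi_n+\psi_n^2$ are not identically zero, and \[ [n](x,y)=\left(\frac{\phi_n\psi_n}{\omega_n}(x,y),\ \frac{\phi_n-\psi_n^2}{\phi_n+\psi_n^2}(x,y)\right). \] Here the two quotients are formed in the function field and then evaluated at $(x,y)$, with values in $\mathbb{P}^1(\overline{k})=\overline{k}\cup\{\infty\}$.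 -/

import Mathlib

open scoped Polynomial.Bivariate

/-- A twisted Edwards curve `a x² + y² = 1 + d x² y²` over a field of characteristic not two,
with `a` and `d` distinct and non-zero. -/
structure TwistedEdwardsCurve (F : Type*) [Field F] where
  a : F
  d : F
  two_ne_zero : (2 : F) ≠ 0
  a_ne_zero : a ≠ 0
  d_ne_zero : d ≠ 0
  a_ne_d : a ≠ d

namespace TwistedEdwardsCurve

section Basic

variable {F : Type*} [Field F] (E : TwistedEdwardsCurve F)

/-- The same curve, considered over an extension field `K` of the field of definition. -/
def baseChange (K : Type*) [Field K] [Algebra F K] : TwistedEdwardsCurve K where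
  a := algebraMap F K E.a
  d := algebraMap F K E.d
  two_ne_zero := by
    have h := (map_ne_zero (algebraMap F K)).2 E.two_ne_zero
    rwa [map_ofNat] at h
  a_ne_zero := (map_ne_zero _).2 E.a_ne_zero
  d_ne_zero := (map_ne_zero _).2 E.d_ne_zero
  a_ne_d := fun h => E.a_ne_d ((algebraMap F K).injective h)

/-- The affine point `(x, y)` lies on the curve. -/
def Equation (x y : F) : Prop :=
  E.a * x ^ 2 + y ^ 2 = 1 + E.d * x ^ 2 * y ^ 2

/-- The polynomial `a x² + y² - 1 - d x² y²`. In `F[X][Y]` the variable `x` is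
`Polynomial.C Polynomial.X`, the variable `y` is `Polynomial.X`, and the constant `c` is
`Polynomial.C (Polynomial.C c)`. -/
noncomputable def polynomial : F[X][Y] :=
  Polynomial.C (Polynomial.C E.a) * Polynomial.C Polynomial.X ^ 2 + Polynomial.X ^ 2 - 1
    - Polynomial.C (Polynomial.C E.d) * Polynomial.C Polynomial.X ^ 2 * Polynomial.X ^ 2

theorem irreducible_polynomial : Irreducible E.polynomial := by
  classical
  set u : Polynomial F := 1 - Polynomial.C E.d * Polynomial.X ^ 2 with hu
  set w : Polynomial F := Polynomial.C E.a * Polynomial.X ^ 2 - 1 with hw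
  have hf : E.polynomial
      = Polynomial.C u * Polynomial.X ^ 2 + Polynomial.C 0 * Polynomial.X + Polynomial.C w := by
    simp only [polynomial, hu, hw, map_sub, map_mul, map_one, map_pow, map_zero]
    ring
  have hudeg : u.natDegree = 2 := by
    have h : u = Polynomial.C (-E.d) * Polynomial.X ^ 2 + Polynomial.C 0 * Polynomial.X
        + Polynomial.C 1 := by
      simp only [hu, map_neg, map_one, map_zero]; ring
    rw [h]
    exact Polynomial.natDegree_quadratic (neg_ne_zero.2 E.d_ne_zero)
  have hu0 : u ≠ 0 := by
    intro h; rw [h] at hudeg; simp at hudeg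
  have hunot : ¬ IsUnit u := by
    intro h
    have := Polynomial.natDegree_eq_zero_of_isUnit h
    omega
  have hcop : IsCoprime u w := by
    refine ⟨Polynomial.C (E.a / (E.a - E.d)), Polynomial.C (E.d / (E.a - E.d)), ?_⟩
    have h1 : E.a - E.d ≠ 0 := sub_ne_zero.2 E.a_ne_d
    have h2 : Polynomial.C (E.a / (E.a - E.d)) * Polynomial.C E.d
        = Polynomial.C (E.d / (E.a - E.d)) * Polynomial.C E.a := by
      rw [← map_mul, ← map_mul]; congr 1; field_simp
    have h3 : Polynomial.C (E.a / (E.a - E.d)) - Polynomial.C (E.d / (E.a - E.d))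
        = (1 : Polynomial F) := by
      rw [← map_sub, ← map_one Polynomial.C]; congr 1; field_simp
    rw [hu, hw]
    linear_combination h3 - Polynomial.X ^ 2 * h2
  have hfdeg : E.polynomial.natDegree = 2 := by
    rw [hf]; exact Polynomial.natDegree_quadratic hu0
  have hf0 : E.polynomial ≠ 0 := by
    intro h; rw [h] at hfdeg; simp at hfdeg
  have hc2 : E.polynomial.coeff 2 = u := by
    rw [hf]; simp
  have hc1 : E.polynomial.coeff 1 = 0 := by
    rw [hf]; simp
  have hc0 : E.polynomial.coeff 0 = w := by
    rw [hf]; simp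
  have key0 : ∀ g h : F[X][Y], E.polynomial = g * h → g.natDegree = 0 → IsUnit g := by
    intro g h hgh hg
    rw [Polynomial.eq_C_of_natDegree_eq_zero hg] at hgh ⊢
    have hu' : g.coeff 0 ∣ u := ⟨h.coeff 2, by rw [← hc2, hgh, Polynomial.coeff_C_mul]⟩
    have hw' : g.coeff 0 ∣ w := ⟨h.coeff 0, by rw [← hc0, hgh, Polynomial.coeff_C_mul]⟩
    exact Polynomial.isUnit_C.2 (hcop.isUnit_of_dvd' hu' hw')
  refine ⟨fun h => ?_, fun {g h} hgh => ?_⟩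
  · have := Polynomial.natDegree_eq_zero_of_isUnit h
    omega
  have hg0 : g ≠ 0 := by rintro rfl; simp at hgh; exact hf0 hgh
  have hh0 : h ≠ 0 := by rintro rfl; simp at hgh; exact hf0 hgh
  have hdeg : g.natDegree + h.natDegree = 2 := by
    rw [← Polynomial.natDegree_mul hg0 hh0, ← hgh, hfdeg]
  by_cases hg : g.natDegree = 0
  · exact Or.inl (key0 g h hgh hg)
  by_cases hh : h.natDegree = 0
  · exact Or.inr (key0 h g (by rw [hgh, mul_comm]) hh)
  exfalso
  have hg1 : g.natDegree ≤ 1 := by omega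
  have hh1 : h.natDegree ≤ 1 := by omega
  obtain ⟨p, q, rfl⟩ := Polynomial.exists_eq_X_add_C_of_natDegree_le_one hg1
  obtain ⟨r, s, rfl⟩ := Polynomial.exists_eq_X_add_C_of_natDegree_le_one hh1
  have hexp : E.polynomial = Polynomial.C (p * r) * Polynomial.X ^ 2
      + Polynomial.C (p * s + q * r) * Polynomial.X + Polynomial.C (q * s) := by
    rw [hgh]; simp only [map_mul, map_add]; ring
  have e2 : p * r = u := by
    rw [← hc2, hexp]; simp [-map_mul, -map_add]
  have e1 : p * s + q * r = 0 := by
    rw [← hc1, hexp]; simp [-map_mul, -map_add, Polynomial.coeff_C]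
  have e0 : q * s = w := by
    rw [← hc0, hexp]; simp
  rw [← e2, ← e0] at hcop
  have hpq : IsCoprime p q := hcop.of_mul_left_left.of_mul_right_left
  have hrs : IsCoprime r s := hcop.of_mul_left_right.of_mul_right_right
  have hpr : p ∣ r := hpq.dvd_of_dvd_mul_left ⟨-s, by linear_combination e1⟩
  have hrp : r ∣ p := hrs.dvd_of_dvd_mul_right ⟨-q, by linear_combination e1⟩
  have hpu : IsUnit p := by
    obtain ⟨c, rfl⟩ := hpr
    have hder := congrArg Polynomial.derivative e2
    have hX : p ∣ Polynomial.C (-(2 * E.d)) * Polynomial.X := by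
      have : Polynomial.derivative u = Polynomial.C (-(2 * E.d)) * Polynomial.X := by
        have hC : (Polynomial.C 2 : Polynomial F) = 2 := map_ofNat _ 2
        simp only [hu, Polynomial.derivative_sub, Polynomial.derivative_one, map_neg, map_mul,
          Polynomial.derivative_C_mul, Polynomial.derivative_X_pow, hC, Nat.cast_ofNat]
        ring
      rw [← this, ← hder]
      simp only [Polynomial.derivative_mul]
      exact ⟨2 * Polynomial.derivative p * c + p * Polynomial.derivative c, by ring⟩
    have hpu' : p ∣ u := ⟨p * c, e2.symm⟩
    have hcop' : IsCoprime (Polynomial.C (-(2 * E.d)) * Polynomial.X) u := by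
      refine ⟨Polynomial.C (-(2⁻¹)) * Polynomial.X, 1, ?_⟩
      have h2 : Polynomial.C (-(2⁻¹) : F) * Polynomial.C (-(2 * E.d)) = Polynomial.C E.d := by
        rw [← map_mul]; congr 1; field_simp [E.two_ne_zero]
      rw [hu]
      linear_combination Polynomial.X ^ 2 * h2
    exact hcop'.isUnit_of_dvd' hX hpu'
  exact hunot (e2 ▸ hpu.mul (isUnit_of_dvd_unit hrp hpu))

/-- The affine coordinate ring `F[x, y] / (a x² + y² - 1 - d x² y²)`. -/
abbrev CoordinateRing : Type _ := AdjoinRoot E.polynomial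

instance isDomain_coordinateRing : IsDomain E.CoordinateRing :=
  AdjoinRoot.isDomain_of_prime E.irreducible_polynomial.prime

/-- The function field of the curve: the fraction field of the coordinate ring. -/
abbrev FunctionField : Type _ := FractionRing E.CoordinateRing

/-- The rational function on the curve that a polynomial in `x` and `y` defines. -/
noncomputable def toFunctionField : F[X][Y] →+* E.FunctionField :=
  (algebraMap E.CoordinateRing E.FunctionField).comp (AdjoinRoot.mk E.polynomial)

/-- The constant `c` as a rational function. -/
noncomputable def const (c : F) : E.FunctionField :=
  E.toFunctionField (Polynomial.C (Polynomial.C c))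

/-- The coordinate `x` as a rational function. -/
noncomputable def xFun : E.FunctionField := E.toFunctionField (Polynomial.C Polynomial.X)

/-- The coordinate `y` as a rational function. -/
noncomputable def yFun : E.FunctionField := E.toFunctionField Polynomial.X

end Basic

section DivisionPolynomials

variable {F : Type*} [Field F] (E : TwistedEdwardsCurve F)

/-- The functions `ψ_n` in the function field. The last case is the recursion for an index
`n + 5` that is either `2 m + 1` (`m ≥ 2`) or `2 m` (`m ≥ 3`), where `m = (n + 5) / 2`. -/
noncomputable def psi : ℕ → E.FunctionField
  | 0 => 0
  | 1 => 1
  | 2 => (E.const E.a - E.const E.d) * (1 + E.yFun) / (E.xFun * (2 * (1 - E.yFun)))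
  | 3 => (E.const E.a - E.const E.d) ^ 3
      * (E.const E.a + 2 * E.const E.a * E.yFun - 2 * E.const E.d * E.yFun ^ 3
        - E.const E.d * E.yFun ^ 4) / (2 * (1 - E.yFun)) ^ 4
  | 4 => 2 * (E.const E.a - E.const E.d) ^ 6 * E.yFun * (1 + E.yFun)
      * (E.const E.a - E.const E.d * E.yFun ^ 4) / (E.xFun * (2 * (1 - E.yFun)) ^ 7)
  | n + 5 =>
      if _h : (n + 5) % 2 = 1 then
        psi ((n + 5) / 2 + 2) * psi ((n + 5) / 2) ^ 3
          - psi ((n + 5) / 2 - 1) * psi ((n + 5) / 2 + 1) ^ 3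
      else
        psi ((n + 5) / 2) / psi 2
          * (psi ((n + 5) / 2 + 2) * psi ((n + 5) / 2 - 1) ^ 2
            - psi ((n + 5) / 2 - 2) * psi ((n + 5) / 2 + 1) ^ 2)
  termination_by n => n
  decreasing_by all_goals omega

/-- The functions `φ_n`, for `n ≥ 1`. -/
noncomputable def phi (n : ℕ) : E.FunctionField :=
  (1 + E.yFun) * E.psi n ^ 2 / (1 - E.yFun)
    - 4 * E.psi (n - 1) * E.psi (n + 1) / (E.const E.a - E.const E.d)

/-- The functions `ω_n`, for `n ≥ 1`. -/
noncomputable def omega (n : ℕ) : E.FunctionField :=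
  2 * E.psi (2 * n) / ((E.const E.a - E.const E.d) * E.psi n)

end DivisionPolynomials

section ProjectiveLine

variable {F : Type*} [Field F]

/-- Homogeneous coordinates `(num z : den z)` of a point `z` of the projective line
`F ∪ {∞}`: `(z : 1)` for finite `z`, and `(1 : 0)` for `∞`. -/
def num (z : OnePoint F) : F := z.elim 1 id

/-- See `num`. -/
def den (z : OnePoint F) : F := z.elim 0 (fun _ => 1)

open Classical in
/-- The point `(s : t)` of the projective line `F ∪ {∞}`, for `(s, t) ≠ (0, 0)`. -/
noncomputable def ratio (s t : F) : OnePoint F :=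
  if t = 0 then OnePoint.infty else OnePoint.some (s / t)

end ProjectiveLine

section Values

variable {F : Type*} [Field F] (E : TwistedEdwardsCurve F)

/-- The rational function `f` takes the value `z`, finite or `∞`, at the affine point `(x, y)` of
the curve: `f = p / q` in the function field for polynomials `p` and `q` that do not
both vanish at `(x, y)`, and `z = (p(x, y) : q(x, y))`. -/
def HasValue (f : E.FunctionField) (x y : F) (z : OnePoint F) : Prop :=
  ∃ p q : F[X][Y], (p.evalEval x y ≠ 0 ∨ q.evalEval x y ≠ 0) ∧
    f * E.toFunctionField q = E.toFunctionField p ∧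
    z = ratio (p.evalEval x y) (q.evalEval x y)

/-- The rational function `f` is regular at the affine point `(x, y)` of the curve. -/
def IsRegularAt (f : E.FunctionField) (x y : F) : Prop :=
  ∃ c : F, E.HasValue f x y (OnePoint.some c)

end Values

section GroupLaw

variable {F : Type*} [Field F] (E : TwistedEdwardsCurve F)

open Classical in
/-- Addition on the completion
`{((X : Z), (Y : T)) : a X² T² + Y² Z² = Z² T² + d X² Y²}` of the curve in `ℙ¹ × ℙ¹`.
The first pair of fractions is the homogeneous form of the Edwards addition rule
`((x₁ y₂ + x₂ y₁) / (1 + d x₁ x₂ y₁ y₂), (y₁ y₂ - a x₁ x₂) / (1 - d x₁ x₂ y₁ y₂))`.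
Where it is undefined (numerator and denominator of a coordinate both vanish), the sum is given
by the second pair, the homogeneous form of the rule
`((x₁ y₁ + x₂ y₂) / (a x₁ x₂ + y₁ y₂), (x₁ y₁ - x₂ y₂) / (x₁ y₂ - x₂ y₁))`,
which defines the same rational map on the curve. On the completion at least one pair
is always defined. -/
noncomputable def add (P Q : OnePoint F × OnePoint F) : OnePoint F × OnePoint F :=
  let X₁ := num P.1
  let Z₁ := den P.1
  let Y₁ := num P.2
  let T₁ := den P.2
  let X₂ := num Q.1
  let Z₂ := den Q.1
  let Y₂ := num Q.2
  let T₂ := den Q.2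
  let X₃ := X₁ * Y₂ * Z₂ * T₁ + X₂ * Y₁ * Z₁ * T₂
  let Z₃ := Z₁ * Z₂ * T₁ * T₂ + E.d * X₁ * X₂ * Y₁ * Y₂
  let Y₃ := Y₁ * Y₂ * Z₁ * Z₂ - E.a * X₁ * X₂ * T₁ * T₂
  let T₃ := Z₁ * Z₂ * T₁ * T₂ - E.d * X₁ * X₂ * Y₁ * Y₂
  let X₃' := X₁ * Y₁ * Z₂ * T₂ + X₂ * Y₂ * Z₁ * T₁
  let Z₃' := E.a * X₁ * X₂ * T₁ * T₂ + Y₁ * Y₂ * Z₁ * Z₂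
  let Y₃' := X₁ * Y₁ * Z₂ * T₂ - X₂ * Y₂ * Z₁ * T₁
  let T₃' := X₁ * Y₂ * Z₂ * T₁ - X₂ * Y₁ * Z₁ * T₂
  if (X₃ ≠ 0 ∨ Z₃ ≠ 0) ∧ (Y₃ ≠ 0 ∨ T₃ ≠ 0) then (ratio X₃ Z₃, ratio Y₃ T₃)
  else (ratio X₃' Z₃', ratio Y₃' T₃')

/-- The multiple `[n] P = P + ⋯ + P` (`n` summands), with `[0] P` the identity `(0, 1)`. -/
noncomputable def multiple : ℕ → OnePoint F × OnePoint F → OnePoint F × OnePoint F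
  | 0, _ => (OnePoint.some 0, OnePoint.some 1)
  | n + 1, P => E.add (multiple n P) P

end GroupLaw

end TwistedEdwardsCurve

/-!
# Division polynomials and multiples of points on a twisted Edwards curve

The twisted Edwards curve is birational to the cubic `y² = x³ + A x² + s² x` with `s = (a - d) / 4`
and `A = (a + d) / 2`: the Edwards point `(x, y)` corresponds to the point with abscissa
`s (1 + y) / (1 - y)` whose ordinate is the abscissa divided by `x`; conversely the Edwards
coordinates of a point of the cubic are `(x / y, (x - s) / (x + s))`. Under this correspondence `ψ n`
is the `n`-th division polynomial of the cubic, `φ n` is the numerator of the abscissa of `[n] P`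
divided by `s`, and `ω n` is the numerator of the ordinate divided by `s`
(`TwistedEdwardsCurve.psi_eq`, `phi_eq`, `omega_eq`). The theorem is therefore the classical
multiplication formula in Edwards coordinates. It has to be established at every point, including
those where some `ψ m` vanishes or where the multiples pass through infinity.

* For a *generic* point over a field, one at which no division polynomial vanishes, the
  multiplication formula follows by strong induction from the chord and tangent formulas
  (`MontgomeryPoint.IsGeneric.hasCoordinates`). Since three collinear points of the cubic satisfy both
  Edwards rules in cross-multiplied form (`MontgomeryPoint.isSum_of_line`), the resulting coordinates
  of `[n] P`, `P` and `[n + 1] P` do so as well.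
* These cross-multiplied rules, the equation of the cubic for `[n] P`, and a Somos-4 relation are
  polynomial identities in three independent parameters. They hold at the universal point over
  `ℤ[u, r, t]`, which is generic, hence over every commutative ring (`MontgomeryPoint.isSum`,
  `kappa_sq`, `psi_somos`).
* Cross-multiplied identities determine a point of the projective line only if the homogeneous
  coordinates do not both vanish. The Somos-4 relation shows that `φ n` and `ψ n` have no common zero
  outside the `2`-torsion (`MontgomeryPoint.phi_ne_zero_of_psi`), so that the formulas for `[n] P`
  give valid homogeneous coordinates; and at each pair of points that matters, at least one of the two
  Edwards rules is defined (`TwistedEdwardsCurve.second_rule_defined`). Induction on `n` now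
  computes `[n] P` on the completion (`TwistedEdwardsCurve.isMultiple_multiple`).
* The division polynomials are not identically zero, also when the characteristic divides the index
  (`MontgomeryPoint.pre_ne_zero`).
* The functions regular at `(x, y)`, paired with their values, form a subring of `F(E) × F`
  (`TwistedEdwardsCurve.values`). The point of the cubic over this subring that projects to the
  generic point and to `P` shows that the value at `(x, y)` of each of the functions above is the
  same expression in the coordinates of `P`.
-/

/-! ### The cubic and its division polynomials -/

/-- A point on a cubic `y² = x³ + A x² + s² x` over a commutative ring, parametrised freely by
`u = x / s`, `r = s / u` and `t = y / x`, from which the coefficients `s` and `A` of the cubic are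
recovered as well. The parameters satisfy no relation, so that an identity between their polynomials
holds over every ring once it holds for indeterminate parameters. Over a field, every point with
`x ≠ 0` of a cubic with `s ≠ 0` arises in this way. -/
structure MontgomeryPoint (S : Type*) where
  u : S
  r : S
  t : S

namespace MontgomeryPoint

section Ring

variable {S T : Type*} [CommRing S] [CommRing T] (p : MontgomeryPoint S) (f : S →+* T)

/-- The square root `s` of the linear coefficient of the cubic. -/
def s : S := p.u * p.r

/-- The abscissa of the point. -/
def x : S := p.u ^ 2 * p.r

/-- The ordinate of the point. -/
def y : S := p.u ^ 2 * p.r * p.t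

/-- The quadratic coefficient of the cubic. -/
def A : S := p.t ^ 2 - p.r * (p.u ^ 2 + 1)

theorem equation : p.y ^ 2 = p.x ^ 3 + p.A * p.x ^ 2 + p.s ^ 2 * p.x := by
  simp only [x, y, A, s]; ring

/-- The value of the third division polynomial. -/
def psiThree : S := 3 * p.x ^ 4 + 4 * p.A * p.x ^ 3 + 6 * p.s ^ 2 * p.x ^ 2 - p.s ^ 4

/-- The value of the quotient of the fourth division polynomial by the second. -/
def psiFour : S :=
  2 * p.x ^ 6 + 4 * p.A * p.x ^ 5 + 10 * p.s ^ 2 * p.x ^ 4 - 10 * p.s ^ 4 * p.x ^ 2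
    - 4 * p.A * p.s ^ 4 * p.x - 2 * p.s ^ 6

/-- The value of the `n`-th division polynomial. -/
def psi (n : ℤ) : S := normEDS (2 * p.y) p.psiThree p.psiFour n

/-- The numerator of the abscissa of `[n] (x, y)`; the denominator is `psi n ^ 2`. -/
def phi (n : ℤ) : S := p.x * p.psi n ^ 2 - p.psi (n + 1) * p.psi (n - 1)

/-- Twice the numerator of the ordinate of `[n] (x, y)`; the denominator is `psi n ^ 3`. -/
def kappa (n : ℤ) : S := complEDS₂ (2 * p.y) p.psiThree p.psiFour n

/-- The image of a point under a ring homomorphism. -/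
def map : MontgomeryPoint T := ⟨f p.u, f p.r, f p.t⟩

theorem map_s : (p.map f).s = f p.s := by simp [map, s]
theorem map_x : (p.map f).x = f p.x := by simp [map, x]
theorem map_y : (p.map f).y = f p.y := by simp [map, y]
theorem map_A : (p.map f).A = f p.A := by simp [map, A]

theorem map_psiThree : (p.map f).psiThree = f p.psiThree := by
  simp [psiThree, map_x, map_s, map_A, map_ofNat]

theorem map_psiFour : (p.map f).psiFour = f p.psiFour := by
  simp [psiFour, map_x, map_s, map_A, map_ofNat]

theorem map_psi (n : ℤ) : (p.map f).psi n = f (p.psi n) := by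
  simp [psi, map_normEDS, map_psiThree, map_psiFour, map_y, map_ofNat]

theorem map_phi (n : ℤ) : (p.map f).phi n = f (p.phi n) := by
  simp [phi, map_psi, map_x]

theorem map_kappa (n : ℤ) : (p.map f).kappa n = f (p.kappa n) := by
  simp [kappa, map_complEDS₂, map_psiThree, map_psiFour, map_y, map_ofNat]

@[simp] theorem psi_zero : p.psi 0 = 0 := normEDS_zero ..
@[simp] theorem psi_one : p.psi 1 = 1 := normEDS_one ..
theorem psi_two : p.psi 2 = 2 * p.y := normEDS_two ..
theorem psi_three : p.psi 3 = p.psiThree := normEDS_three ..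
theorem psi_four : p.psi 4 = p.psiFour * (2 * p.y) := normEDS_four ..
theorem psi_neg (n : ℤ) : p.psi (-n) = -p.psi n := normEDS_neg ..

theorem psi_odd (m : ℤ) : p.psi (2 * m + 1) =
    p.psi (m + 2) * p.psi m ^ 3 - p.psi (m - 1) * p.psi (m + 1) ^ 3 := normEDS_odd ..

theorem psi_even (m : ℤ) : p.psi (2 * m) * (2 * p.y) =
    p.psi m * (p.psi (m + 2) * p.psi (m - 1) ^ 2 - p.psi (m - 2) * p.psi (m + 1) ^ 2) := by
  rw [psi, normEDS_even]; simp only [psi]; ring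

theorem psi_mul_kappa (n : ℤ) : p.psi n * p.kappa n = p.psi (2 * n) := normEDS_mul_complEDS₂ ..

theorem kappa_mul_two_y (n : ℤ) : p.kappa n * (2 * p.y) =
    p.psi (n - 1) ^ 2 * p.psi (n + 2) - p.psi (n - 2) * p.psi (n + 1) ^ 2 := complEDS₂_mul_b ..

@[simp] theorem phi_zero : p.phi 0 = 1 := by
  simp [phi, psi_neg]

@[simp] theorem phi_one : p.phi 1 = p.x := by simp [phi]
@[simp] theorem kappa_zero : p.kappa 0 = 2 := complEDS₂_zero ..
@[simp] theorem kappa_one : p.kappa 1 = 2 * p.y := complEDS₂_one ..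
theorem kappa_two : p.kappa 2 = p.psiFour := complEDS₂_two ..

end Ring

section Cubic

/-! ### The group law on the cubic `y² = x³ + A x² + B x` -/

variable {L : Type*} [Field L]

/-- The Weierstrass curve `y² = x³ + A x² + B x`. -/
def cubic (A B : L) : WeierstrassCurve.Affine L := ⟨0, A, 0, B, 0⟩

theorem cubic_equation {A B x y : L} :
    (cubic A B).Equation x y ↔ y ^ 2 = x ^ 3 + A * x ^ 2 + B * x := by
  rw [WeierstrassCurve.Affine.equation_iff]; simp [cubic]

/-- For the abscissa `X` of the points of the cubic, the identity
`(X(P) - X(2Q)) (2 Y(Q))² = (X(Q) - X(Q + P)) (X(Q - P) - X(Q)) (X(P) - X(Q))²` with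
`P = (x₀, y₀)` and `Q = (x, y)`, where the abscissas of `Q ± P` and `2Q` are given by the chord and
tangent formulas. -/
theorem double_sub_identity {A B x y x₀ y₀ : L} (hQ : y ^ 2 = x ^ 3 + A * x ^ 2 + B * x)
    (hP : y₀ ^ 2 = x₀ ^ 3 + A * x₀ ^ 2 + B * x₀) (h : x - x₀ ≠ 0) (hy : 2 * y ≠ 0) :
    (x₀ - (((3 * x ^ 2 + 2 * A * x + B) / (2 * y)) ^ 2 - A - x - x)) * (2 * y) ^ 2 =
      (x - (((y - y₀) / (x - x₀)) ^ 2 - A - x - x₀)) *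
        (((y + y₀) / (x - x₀)) ^ 2 - A - x - x₀ - x) * (x₀ - x) ^ 2 := by
  have e1 : (x₀ - (((3 * x ^ 2 + 2 * A * x + B) / (2 * y)) ^ 2 - A - x - x)) * (2 * y) ^ 2
      = (x₀ + A + 2 * x) * (4 * y ^ 2) - (3 * x ^ 2 + 2 * A * x + B) ^ 2 := by
    have h2 := left_ne_zero_of_mul hy
    have hy' := right_ne_zero_of_mul hy
    field_simp; ring
  have e2 : (x - (((y - y₀) / (x - x₀)) ^ 2 - A - x - x₀)) *
      (((y + y₀) / (x - x₀)) ^ 2 - A - x - x₀ - x) * (x₀ - x) ^ 2 = -(((A + 2 * x + x₀) * (x - x₀)^2)^2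
       - 2 * ((A + 2 * x + x₀) * (x - x₀)^2) * (y ^ 2 + y₀ ^ 2) + (y ^ 2 - y₀ ^ 2) ^ 2)
       / (x - x₀) ^ 2 := by
    field_simp; ring
  rw [e1, e2, eq_div_iff (pow_ne_zero 2 h), hQ, hP]
  ring

/-- The product `(X(P) - X(Q + P)) (X(P) - X(Q - P)) (X(P) - X(Q))²` for `P = (x₀, y₀)` and
`Q = (x, y)`; it yields the Somos-4 relation for the division polynomials. -/
theorem add_mul_sub_identity {A B x y x₀ y₀ : L} (hQ : y ^ 2 = x ^ 3 + A * x ^ 2 + B * x)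
    (hP : y₀ ^ 2 = x₀ ^ 3 + A * x₀ ^ 2 + B * x₀) (h : x - x₀ ≠ 0) :
    (x₀ - (((y - y₀) / (x - x₀)) ^ 2 - A - x - x₀)) *
        (x₀ - (((y + y₀) / (x - x₀)) ^ 2 - A - x - x₀)) * (x₀ - x) ^ 2 = (2 * y₀) ^ 2 * (x₀ - x) -
          (3 * x₀ ^ 4 + 4 * A * x₀ ^ 3 + 6 * B * x₀ ^ 2 - B ^ 2) := by
  have e2 : (x₀ - (((y - y₀) / (x - x₀)) ^ 2 - A - x - x₀)) *
      (x₀ - (((y + y₀) / (x - x₀)) ^ 2 - A - x - x₀)) * (x₀ - x) ^ 2 =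
      (((A + x + 2 * x₀) * (x - x₀)^2)^2
       - 2 * ((A + x + 2 * x₀) * (x - x₀)^2) * (y ^ 2 + y₀ ^ 2) + (y ^ 2 - y₀ ^ 2) ^ 2)
       / (x - x₀) ^ 2 := by
    field_simp; ring
  rw [e2, div_eq_iff (pow_ne_zero 2 h), show (2 * y₀) ^ 2 = 4 * y₀ ^ 2 by ring, hQ, hP]
  ring

variable {A B : L}

open WeierstrassCurve.Affine in
theorem cubic_add_of_ne [DecidableEq L] {x₁ y₁ x₂ y₂ : L} {h₁ : (cubic A B).Nonsingular x₁ y₁}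
    {h₂ : (cubic A B).Nonsingular x₂ y₂} (hx : x₁ ≠ x₂) :
    ∃ h, Point.some x₁ y₁ h₁ + Point.some x₂ y₂ h₂ =
      Point.some (((y₁ - y₂) / (x₁ - x₂)) ^ 2 - A - x₁ - x₂)
        (-((y₁ - y₂) / (x₁ - x₂) * (((y₁ - y₂) / (x₁ - x₂)) ^ 2 - A - x₁ - x₂ - x₁) + y₁)) h := by
  have hX : (cubic A B).addX x₁ x₂ ((cubic A B).slope x₁ x₂ y₁ y₂)
      = ((y₁ - y₂) / (x₁ - x₂)) ^ 2 - A - x₁ - x₂ := by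
    rw [slope_of_X_ne hx]; simp [addX, cubic]
  have hY : (cubic A B).addY x₁ x₂ y₁ ((cubic A B).slope x₁ x₂ y₁ y₂)
      = -((y₁ - y₂) / (x₁ - x₂) * (((y₁ - y₂) / (x₁ - x₂)) ^ 2 - A - x₁ - x₂ - x₁) + y₁) := by
    rw [slope_of_X_ne hx]; simp [addY, negY, negAddY, addX, cubic]
  rw [← hY, ← hX]
  exact ⟨_, Point.add_of_X_ne hx⟩

open WeierstrassCurve.Affine in
theorem cubic_neg {x y : L} {h : (cubic A B).Nonsingular x y} :
    ∃ h', -Point.some x y h = Point.some x (-y) h' := by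
  have hY : (cubic A B).negY x y = -y := by simp [negY, cubic]
  rw [← hY]
  exact ⟨_, Point.neg_some h⟩

open WeierstrassCurve.Affine in
theorem cubic_sub_of_ne [DecidableEq L] {x₁ y₁ x₂ y₂ : L} {h₁ : (cubic A B).Nonsingular x₁ y₁}
    {h₂ : (cubic A B).Nonsingular x₂ y₂} (hx : x₁ ≠ x₂) :
    ∃ y h, Point.some x₁ y₁ h₁ - Point.some x₂ y₂ h₂ =
      Point.some (((y₁ + y₂) / (x₁ - x₂)) ^ 2 - A - x₁ - x₂) y h := by
  obtain ⟨h', e⟩ := cubic_neg (h := h₂)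
  obtain ⟨h, e'⟩ := cubic_add_of_ne (h₁ := h₁) (h₂ := h') hx
  rw [sub_eq_add_neg (Point.some x₁ y₁ h₁), e, e', ← sub_neg_eq_add y₁ y₂]
  exact ⟨_, h, rfl⟩

open WeierstrassCurve.Affine in
theorem cubic_add_self [DecidableEq L] {x y : L} {h₁ : (cubic A B).Nonsingular x y}
    (hy : 2 * y ≠ 0) :
    ∃ h, Point.some x y h₁ + Point.some x y h₁ =
      Point.some (((3 * x ^ 2 + 2 * A * x + B) / (2 * y)) ^ 2 - A - x - x)
        (-((3 * x ^ 2 + 2 * A * x + B) / (2 * y) *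
          (((3 * x ^ 2 + 2 * A * x + B) / (2 * y)) ^ 2 - A - x - x - x) + y)) h := by
  have hy' : y ≠ (cubic A B).negY x y := by
    intro h; apply hy; simp [negY, cubic] at h; linear_combination h
  have hs : (cubic A B).slope x x y y = (3 * x ^ 2 + 2 * A * x + B) / (2 * y) := by
    rw [slope_of_Y_ne rfl hy']; simp [negY, cubic]; ring
  have hX : (cubic A B).addX x x ((cubic A B).slope x x y y)
      = ((3 * x ^ 2 + 2 * A * x + B) / (2 * y)) ^ 2 - A - x - x := by
    rw [hs]; simp [addX, cubic]
  have hY : (cubic A B).addY x x y ((cubic A B).slope x x y y)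
      = (-((3 * x ^ 2 + 2 * A * x + B) / (2 * y) *
          (((3 * x ^ 2 + 2 * A * x + B) / (2 * y)) ^ 2 - A - x - x - x) + y)) := by
    rw [hs]; simp [addY, negY, negAddY, addX, cubic]
  rw [← hY, ← hX]
  exact ⟨_, Point.add_self_of_Y_ne hy'⟩

end Cubic

end MontgomeryPoint

/-! ### Multiples of a generic point -/

namespace MontgomeryPoint

section Generic

open WeierstrassCurve.Affine

variable {L : Type*} [Field L] (p : MontgomeryPoint L)

/-- The expected abscissa of `[n] (x, y)`. -/
def abscissa (n : ℤ) : L := p.x - p.psi (n + 1) * p.psi (n - 1) / p.psi n ^ 2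

/-- The expected ordinate of `[n] (x, y)`. -/
def ordinate (n : ℤ) : L := p.kappa n / (2 * p.psi n ^ 3)

/-- No division polynomial vanishes at the point, which is thus not a torsion point. -/
structure IsGeneric : Prop where
  two_ne_zero : (2 : L) ≠ 0
  psi_ne_zero : ∀ n : ℤ, 0 < n → p.psi n ≠ 0

variable {p}

theorem IsGeneric.two_y_ne_zero (hp : p.IsGeneric) : 2 * p.y ≠ 0 := by
  rw [← p.psi_two]; exact hp.psi_ne_zero 2 (by norm_num)

theorem IsGeneric.nonsingular (hp : p.IsGeneric) : (cubic p.A (p.s ^ 2)).Nonsingular p.x p.y := by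
  rw [nonsingular_iff]
  refine ⟨cubic_equation.2 p.equation, Or.inr fun h => hp.two_y_ne_zero ?_⟩
  simp [cubic] at h
  linear_combination h

/-- The point `(x, y)` on the Weierstrass curve `y² = x³ + A x² + s² x`. -/
def IsGeneric.point (hp : p.IsGeneric) : (cubic p.A (p.s ^ 2)).Point := .some _ _ hp.nonsingular

theorem IsGeneric.kappa_ne_zero (hp : p.IsGeneric) {n : ℤ} (hn : 0 < n) : p.kappa n ≠ 0 := by
  intro h
  apply hp.psi_ne_zero (2 * n) (by omega)
  rw [← psi_mul_kappa, h, mul_zero]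

theorem IsGeneric.abscissa_sub_ne_zero (hp : p.IsGeneric) {n : ℤ} (hn : 1 < n) :
    p.abscissa n - p.x ≠ 0 := by
  have h : p.abscissa n - p.x = -(p.psi (n + 1) * p.psi (n - 1) / p.psi n ^ 2) := by
    rw [abscissa]; ring
  rw [h]
  exact neg_ne_zero.2 (div_ne_zero (mul_ne_zero (hp.psi_ne_zero _ (by omega))
    (hp.psi_ne_zero _ (by omega))) (pow_ne_zero 2 (hp.psi_ne_zero _ (by omega))))

variable [DecidableEq L]

/-- The abscissa of `[n] (x, y)` is the expected one. -/
def IsGeneric.HasAbscissa (hp : p.IsGeneric) (n : ℕ) : Prop :=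
  ∃ y h, n • hp.point = .some (p.abscissa n) y h

/-- Both coordinates of `[n] (x, y)` are the expected ones. -/
def IsGeneric.HasCoordinates (hp : p.IsGeneric) (n : ℕ) : Prop :=
  ∃ h, n • hp.point = .some (p.abscissa n) (p.ordinate n) h

theorem IsGeneric.HasCoordinates.hasAbscissa {hp : p.IsGeneric} {n : ℕ}
    (h : hp.HasCoordinates n) : hp.HasAbscissa n := ⟨_, h⟩

theorem IsGeneric.hasCoordinates_one (hp : p.IsGeneric) : hp.HasCoordinates 1 := by
  have hX : p.abscissa (1 : ℕ) = p.x := by simp [abscissa]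
  have hY : p.ordinate (1 : ℕ) = p.y := by
    simp only [ordinate, Nat.cast_one, kappa_one, psi_one, one_pow, mul_one]
    exact mul_div_cancel_left₀ _ hp.two_ne_zero
  rw [HasCoordinates, hX, hY, one_smul]
  exact ⟨hp.nonsingular, rfl⟩

/-- The abscissas of three consecutive multiples determine the ordinate of the middle one: if
`Q = [m + 1] P`, then the difference of the abscissas of `Q - P` and `Q + P` is, by the chord formula,
a known multiple of the product of the ordinates of `P` and `Q`. -/
theorem IsGeneric.hasCoordinates_of_hasAbscissa (hp : p.IsGeneric) {m : ℕ} (hm : 1 ≤ m)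
    (h0 : hp.HasAbscissa m) (h1 : hp.HasAbscissa (m + 1)) (h2 : hp.HasAbscissa (m + 2)) :
    hp.HasCoordinates (m + 1) := by
  obtain ⟨y0, n0, e0⟩ := h0
  obtain ⟨y, n1, e1⟩ := h1
  obtain ⟨y2, n2, e2⟩ := h2
  have hx : p.abscissa (m + 1 : ℕ) - p.x ≠ 0 := hp.abscissa_sub_ne_zero (by push_cast; omega)
  obtain ⟨na, ea⟩ := cubic_add_of_ne (h₁ := n1) (h₂ := hp.nonsingular) (sub_ne_zero.1 hx)
  obtain ⟨ys, ns, es⟩ := cubic_sub_of_ne (h₁ := n1) (h₂ := hp.nonsingular) (sub_ne_zero.1 hx)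
  have fa : (m + 2) • hp.point = (m + 1) • hp.point + hp.point := by rw [← succ_nsmul]
  have fs : m • hp.point = (m + 1) • hp.point - hp.point := by rw [succ_nsmul, add_sub_cancel_right]
  have ga := ea.symm.trans ((by rw [e1]; rfl : _ = _ + hp.point).trans (fa.symm.trans e2))
  have gs := es.symm.trans ((by rw [e1]; rfl : _ = _ - hp.point).trans (fs.symm.trans e0))
  have ka := (Point.some.inj ga).1
  have ks := (Point.some.inj gs).1
  have hκ := p.kappa_mul_two_y (m + 1 : ℤ)
  have z0 : p.psi m ≠ 0 := hp.psi_ne_zero _ (by omega)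
  have z1 : p.psi (m + 1) ≠ 0 := hp.psi_ne_zero _ (by omega)
  have z2 : p.psi (m + 2) ≠ 0 := hp.psi_ne_zero _ (by omega)
  have hY := right_ne_zero_of_mul hp.two_y_ne_zero
  have h2 := hp.two_ne_zero
  have key : y = p.ordinate (m + 1 : ℕ) := by
    have d : p.abscissa m - p.abscissa (m + 2 : ℕ) =
        4 * y * p.y / (p.abscissa (m + 1 : ℕ) - p.x) ^ 2 := by
      rw [← ka, ← ks]; field_simp; ring
    simp only [abscissa, ordinate, Nat.cast_add, Nat.cast_one, Nat.cast_ofNat] at d ⊢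
    simp only [show (m + 1 + 1 : ℤ) = m + 2 by ring, show (m + 1 - 1 : ℤ) = m by ring,
      show (m + 2 - 1 : ℤ) = m + 1 by ring, show (m + 1 + 2 : ℤ) = m + 2 + 1 by ring,
      show (m + 1 - 2 : ℤ) = m - 1 by ring] at d hκ ⊢
    generalize p.psi m = a0 at *
    generalize p.psi (m + 1) = a1 at *
    generalize p.psi (m + 2) = a2 at *
    generalize p.psi (m + 2 + 1) = a3 at *
    generalize p.psi (m - 1) = am at *
    generalize p.kappa (m + 1) = k at *
    have e : (p.x - a2 * a0 / a1 ^ 2 - p.x) = - (a2 * a0 / a1 ^ 2) := by ring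
    rw [e] at d
    rw [eq_div_iff (by positivity)]
    have d' : (a0 ^ 2 * a3 - am * a2 ^ 2) * (a1 * (a0 ^ 2 * a2 ^ 2))
        = 4 * y * p.y * a1 ^ 4 * (a0 ^ 2 * a2 ^ 2) := by
      field_simp at d
      linear_combination (a0 ^ 2 * a2 ^ 2) * d
    rw [← hκ] at d'
    have : (2 * p.y * a1 * (a0 ^ 2 * a2 ^ 2)) * (y * (2 * a1 ^ 3)) =
        (2 * p.y * a1 * (a0 ^ 2 * a2 ^ 2)) * k := by
      linear_combination -d'
    exact mul_left_cancel₀ (by simp [*]) this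
  subst key
  exact ⟨n1, e1⟩

/-- The abscissa of the even multiple `[2 (m + 1)] P = [2] Q` is found from those of `Q = [m + 1] P`
and of `Q ± P`. -/
theorem IsGeneric.hasAbscissa_two_mul (hp : p.IsGeneric) {m : ℕ} (hm : 1 ≤ m)
    (h0 : hp.HasAbscissa m) (h1 : hp.HasAbscissa (m + 1)) (h2 : hp.HasAbscissa (m + 2)) :
    hp.HasAbscissa (2 * (m + 1)) := by
  obtain ⟨n1, e1⟩ := hp.hasCoordinates_of_hasAbscissa hm h0 h1 h2
  obtain ⟨y0, n0, e0⟩ := h0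
  obtain ⟨y2, n2, e2⟩ := h2
  have hx : p.abscissa (m + 1 : ℕ) - p.x ≠ 0 := hp.abscissa_sub_ne_zero (by push_cast; omega)
  obtain ⟨na, ea⟩ := cubic_add_of_ne (h₁ := n1) (h₂ := hp.nonsingular) (sub_ne_zero.1 hx)
  obtain ⟨ys, ns, es⟩ := cubic_sub_of_ne (h₁ := n1) (h₂ := hp.nonsingular) (sub_ne_zero.1 hx)
  have fa : (m + 2) • hp.point = (m + 1) • hp.point + hp.point := by rw [← succ_nsmul]
  have fs : m • hp.point = (m + 1) • hp.point - hp.point := by rw [succ_nsmul, add_sub_cancel_right]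
  have ga := ea.symm.trans ((by rw [e1]; rfl : _ = _ + hp.point).trans (fa.symm.trans e2))
  have gs := es.symm.trans ((by rw [e1]; rfl : _ = _ - hp.point).trans (fs.symm.trans e0))
  have ka := (Point.some.inj ga).1
  have ks := (Point.some.inj gs).1
  have z0 : p.psi m ≠ 0 := hp.psi_ne_zero _ (by omega)
  have z1 : p.psi (m + 1) ≠ 0 := hp.psi_ne_zero _ (by omega)
  have z2 : p.psi (m + 2) ≠ 0 := hp.psi_ne_zero _ (by omega)
  have z3 : p.psi (2 * (m + 1)) ≠ 0 := hp.psi_ne_zero _ (by omega)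
  have zκ : p.kappa (m + 1) ≠ 0 := hp.kappa_ne_zero (by omega)
  have h2 := hp.two_ne_zero
  have hy : 2 * p.ordinate (m + 1 : ℕ) ≠ 0 := by
    rw [ordinate]; push_cast
    exact mul_ne_zero h2 (div_ne_zero zκ (mul_ne_zero h2 (pow_ne_zero 3 z1)))
  obtain ⟨nd, ed⟩ := cubic_add_self (h₁ := n1) hy
  have key := double_sub_identity (cubic_equation.1 n1.1) p.equation hx hy
  rw [ka, ks] at key
  rw [HasAbscissa, mul_smul, two_smul, e1, ed]
  suffices h : p.abscissa (2 * (m + 1) : ℕ) = _ by rw [h]; exact ⟨_, nd, rfl⟩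
  have o1 := p.psi_odd (m + 1 : ℤ)
  have o2 := p.psi_odd (m : ℤ)
  rw [show p.abscissa (2 * (m + 1) : ℕ) = p.x - (p.x - p.abscissa (2 * (m + 1) : ℕ)) by ring,
    sub_eq_iff_eq_add, add_comm, ← sub_eq_iff_eq_add]
  rw [← eq_div_iff (pow_ne_zero 2 hy)] at key
  rw [key, div_eq_iff (pow_ne_zero 2 hy)]
  simp only [abscissa, ordinate, Nat.cast_add, Nat.cast_one, Nat.cast_ofNat, Nat.cast_mul]
  rw [show (2 * (m + 1) - 1 : ℤ) = 2 * m + 1 by ring, o1, o2, ← psi_mul_kappa]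
  simp only [show (m + 1 + 1 : ℤ) = m + 2 by ring, show (m + 1 - 1 : ℤ) = m by ring,
      show (m + 2 - 1 : ℤ) = m + 1 by ring, show (m + 1 + 2 : ℤ) = m + 2 + 1 by ring]
  field_simp
  ring

/-- The odd multiple `[2 m + 1] P` is `[m + 1] P + [m] P`, while the difference of the two
summands is `P`. -/
theorem IsGeneric.hasAbscissa_two_mul_add_one (hp : p.IsGeneric) {m : ℕ} (hm : 1 ≤ m)
    (h0 : hp.HasCoordinates m) (h1 : hp.HasCoordinates (m + 1)) :
    hp.HasAbscissa (2 * m + 1) := by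
  obtain ⟨n0, e0⟩ := h0
  obtain ⟨n1, e1⟩ := h1
  have z0 : p.psi m ≠ 0 := hp.psi_ne_zero _ (by omega)
  have z1 : p.psi (m + 1) ≠ 0 := hp.psi_ne_zero _ (by omega)
  have z2 : p.psi (2 * m + 1) ≠ 0 := hp.psi_ne_zero _ (by omega)
  have h2 := hp.two_ne_zero
  have o := p.psi_odd (m : ℤ)
  have hx' : p.abscissa (m + 1 : ℕ) - p.abscissa m =
      -p.psi (2 * m + 1) / (p.psi m ^ 2 * p.psi (m + 1) ^ 2) := by
    simp only [abscissa, Nat.cast_add, Nat.cast_one, o]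
    simp only [show (m + 1 + 1 : ℤ) = m + 2 by ring, show (m + 1 - 1 : ℤ) = m by ring]
    field_simp
    ring
  have hx : p.abscissa (m + 1 : ℕ) - p.abscissa m ≠ 0 := by
    rw [hx']
    exact div_ne_zero (neg_ne_zero.2 z2) (mul_ne_zero (pow_ne_zero 2 z0) (pow_ne_zero 2 z1))
  obtain ⟨na, ea⟩ := cubic_add_of_ne (h₁ := n1) (h₂ := n0) (sub_ne_zero.1 hx)
  obtain ⟨ys, ns, es⟩ := cubic_sub_of_ne (h₁ := n1) (h₂ := n0) (sub_ne_zero.1 hx)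
  have fa : (2 * m + 1) • hp.point = (m + 1) • hp.point + m • hp.point := by
    rw [← add_smul]; congr 1; omega
  have fs : hp.point = (m + 1) • hp.point - m • hp.point := by
    rw [succ_nsmul, add_sub_cancel_left]
  have gs := es.symm.trans ((by rw [e1, e0] : _ = _).trans fs.symm)
  have ks := (Point.some.inj gs).1
  rw [HasAbscissa, fa, e1, e0, ea]
  suffices h : p.abscissa (2 * m + 1 : ℕ) = _ by rw [h]; exact ⟨_, na, rfl⟩
  have d : p.x - 4 * p.ordinate (m + 1 : ℕ) * p.ordinate m /
      (p.abscissa (m + 1 : ℕ) - p.abscissa m) ^ 2 =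
      ((p.ordinate (m + 1 : ℕ) - p.ordinate m) / (p.abscissa (m + 1 : ℕ) - p.abscissa m)) ^ 2
        - p.A - p.abscissa (m + 1 : ℕ) - p.abscissa m := by
    rw [← ks]; field_simp; ring
  rw [← d, hx']
  simp only [abscissa, ordinate, Nat.cast_add, Nat.cast_one, Nat.cast_mul, Nat.cast_ofNat]
  rw [show (2 * m + 1 + 1 : ℤ) = 2 * (m + 1) by ring, show (2 * m + 1 - 1 : ℤ) = 2 * m by ring,
    ← psi_mul_kappa, ← psi_mul_kappa]
  field_simp
  ring

theorem IsGeneric.hasCoordinates_two (hp : p.IsGeneric) : hp.HasCoordinates 2 := by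
  obtain ⟨nd, ed⟩ := cubic_add_self (h₁ := hp.nonsingular) hp.two_y_ne_zero
  have hY := right_ne_zero_of_mul hp.two_y_ne_zero
  have h2 := hp.two_ne_zero
  have eX : p.abscissa (2 : ℕ) =
      ((3 * p.x ^ 2 + 2 * p.A * p.x + p.s ^ 2) / (2 * p.y)) ^ 2 - p.A - p.x - p.x := by
    simp only [abscissa, Nat.cast_ofNat, show (2 + 1 : ℤ) = 3 by norm_num,
      show (2 - 1 : ℤ) = 1 by norm_num, psi_two, psi_one, psi_three, psiThree]
    field_simp
    linear_combination (4 * (3 * p.x + p.A)) * p.equation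
  have eY : p.ordinate (2 : ℕ) =
      -((3 * p.x ^ 2 + 2 * p.A * p.x + p.s ^ 2) / (2 * p.y) *
        (((3 * p.x ^ 2 + 2 * p.A * p.x + p.s ^ 2) / (2 * p.y)) ^ 2 - p.A - p.x - p.x - p.x)
          + p.y) := by
    have e : -((3 * p.x ^ 2 + 2 * p.A * p.x + p.s ^ 2) / (2 * p.y) *
        (((3 * p.x ^ 2 + 2 * p.A * p.x + p.s ^ 2) / (2 * p.y)) ^ 2 - p.A - p.x - p.x - p.x)
          + p.y) = -((3 * p.x ^ 2 + 2 * p.A * p.x + p.s ^ 2) ^ 3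
            - (p.A + 3 * p.x) * (3 * p.x ^ 2 + 2 * p.A * p.x + p.s ^ 2) * (4 * p.y ^ 2)
            + 8 * (p.y ^ 2) ^ 2) / (8 * p.y ^ 3) := by
      rw [show (8 : L) = 2 ^ 3 by norm_num]
      field_simp; ring
    have h16 : (8 * p.y ^ 3 : L) ≠ 0 := by
      rw [show (8 : L) = 2 ^ 3 by norm_num]
      exact mul_ne_zero (pow_ne_zero 3 h2) (pow_ne_zero 3 hY)
    rw [e, eq_div_iff h16, ordinate, Nat.cast_ofNat, psi_two, kappa_two, p.equation,
      show p.psiFour / (2 * (2 * p.y) ^ 3) * (8 * p.y ^ 3) = p.psiFour / 2 by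
        rw [mul_pow]; field_simp; ring, div_eq_iff h2, psiFour]
    ring
  rw [HasCoordinates, two_smul, eX, eY]
  exact ⟨nd, ed⟩

theorem IsGeneric.hasAbscissa (hp : p.IsGeneric) (n : ℕ) : n ≠ 0 → hp.HasAbscissa n := by
  have h1 := hp.hasCoordinates_one
  have h2 := hp.hasCoordinates_two
  have h3 := hp.hasAbscissa_two_mul_add_one le_rfl h1 h2
  induction n using normEDSRec with
  | zero => exact fun h => (h rfl).elim
  | one => exact fun _ => h1.hasAbscissa
  | two => exact fun _ => h2.hasAbscissa
  | three => exact fun _ => h3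
  | four => exact fun _ => hp.hasAbscissa_two_mul le_rfl h1.hasAbscissa h2.hasAbscissa h3
  | even m _ i2 i3 i4 _ =>
    exact fun _ => hp.hasAbscissa_two_mul (m := m + 2) (by omega) (i2 (by omega)) (i3 (by omega))
      (i4 (by omega))
  | odd m i1 i2 i3 i4 =>
    exact fun _ => hp.hasAbscissa_two_mul_add_one (m := m + 2) (by omega)
      (hp.hasCoordinates_of_hasAbscissa (m := m + 1) (by omega) (i1 (by omega)) (i2 (by omega))
        (i3 (by omega)))
      (hp.hasCoordinates_of_hasAbscissa (m := m + 2) (by omega) (i2 (by omega)) (i3 (by omega))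
        (i4 (by omega)))

/-- In the generic case, the multiples of the point are given by the division polynomials. -/
theorem IsGeneric.hasCoordinates (hp : p.IsGeneric) {n : ℕ} (hn : n ≠ 0) :
    hp.HasCoordinates n := by
  obtain _ | _ | n := n
  · exact (hn rfl).elim
  · exact hp.hasCoordinates_one
  · exact hp.hasCoordinates_of_hasAbscissa (by omega) (hp.hasAbscissa _ (by omega))
      (hp.hasAbscissa _ (by omega)) (hp.hasAbscissa _ (by omega))

end Generic

end MontgomeryPoint

/-! ### The Edwards addition rules on the cubic -/

namespace MontgomeryPoint

section Ring

variable {S T : Type*} [CommRing S] [CommRing T] (p : MontgomeryPoint S) (f : S →+* T)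

/-- Homogeneous coordinates `((X' : Z'), (Y' : T'))` are cross-proportional to the values of both
Edwards addition rules at `((X₁ : Z₁), (Y₁ : T₁))` and at the Edwards point
`((x : y), (x - s : x + s))` that corresponds to `p`. The parameters of the Edwards curve are
`A + 2 s` and `A - 2 s`. -/
def IsSum (X₁ Z₁ Y₁ T₁ X' Z' Y' T' : S) : Prop :=
  X' * (Z₁ * p.y * T₁ * (p.x + p.s) + (p.A - 2 * p.s) * X₁ * p.x * Y₁ * (p.x - p.s)) =
      Z' * (X₁ * (p.x - p.s) * p.y * T₁ + p.x * Y₁ * Z₁ * (p.x + p.s)) ∧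
    Y' * (Z₁ * p.y * T₁ * (p.x + p.s) - (p.A - 2 * p.s) * X₁ * p.x * Y₁ * (p.x - p.s)) =
      T' * (Y₁ * (p.x - p.s) * Z₁ * p.y - (p.A + 2 * p.s) * X₁ * p.x * T₁ * (p.x + p.s)) ∧
    X' * ((p.A + 2 * p.s) * X₁ * p.x * T₁ * (p.x + p.s) + Y₁ * (p.x - p.s) * Z₁ * p.y) =
      Z' * (X₁ * Y₁ * p.y * (p.x + p.s) + p.x * (p.x - p.s) * Z₁ * T₁) ∧
    Y' * (X₁ * (p.x - p.s) * p.y * T₁ - p.x * Y₁ * Z₁ * (p.x + p.s)) =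
      T' * (X₁ * Y₁ * p.y * (p.x + p.s) - p.x * (p.x - p.s) * Z₁ * T₁)

variable {p}

theorem IsSum.scale {X₁ Z₁ Y₁ T₁ X' Z' Y' T' : S} (h : p.IsSum X₁ Z₁ Y₁ T₁ X' Z' Y' T')
    (e c e' c' : S) :
    p.IsSum (e * X₁) (e * Z₁) (c * Y₁) (c * T₁) (e' * X') (e' * Z') (c' * Y') (c' * T') := by
  obtain ⟨h1, h2, h3, h4⟩ := h
  refine ⟨?_, ?_, ?_, ?_⟩
  · linear_combination (e * c * e') * h1
  · linear_combination (e * c * c') * h2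
  · linear_combination (e * c * e') * h3
  · linear_combination (e * c * c') * h4

theorem IsSum.of_scale [IsDomain S] {X₁ Z₁ Y₁ T₁ X' Z' Y' T' e c : S} (he : e ≠ 0) (hc : c ≠ 0)
    (h : p.IsSum (e * X₁) (e * Z₁) (c * Y₁) (c * T₁) X' Z' Y' T') :
    p.IsSum X₁ Z₁ Y₁ T₁ X' Z' Y' T' := by
  obtain ⟨h1, h2, h3, h4⟩ := h
  have hec := mul_ne_zero he hc
  refine ⟨mul_left_cancel₀ hec ?_, mul_left_cancel₀ hec ?_, mul_left_cancel₀ hec ?_,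
    mul_left_cancel₀ hec ?_⟩
  · linear_combination h1
  · linear_combination h2
  · linear_combination h3
  · linear_combination h4

theorem IsSum.map {X₁ Z₁ Y₁ T₁ X' Z' Y' T' : S} (h : p.IsSum X₁ Z₁ Y₁ T₁ X' Z' Y' T') :
    (p.map f).IsSum (f X₁) (f Z₁) (f Y₁) (f T₁) (f X') (f Z') (f Y') (f T') := by
  obtain ⟨h1, h2, h3, h4⟩ := h
  have h1 := congrArg f h1
  have h2 := congrArg f h2
  have h3 := congrArg f h3
  have h4 := congrArg f h4
  simp only [map_add, map_sub, map_mul, map_ofNat] at h1 h2 h3 h4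
  exact ⟨by simpa only [map_x, map_y, map_s, map_A] using h1,
    by simpa only [map_x, map_y, map_s, map_A] using h2,
    by simpa only [map_x, map_y, map_s, map_A] using h3,
    by simpa only [map_x, map_y, map_s, map_A] using h4⟩

theorem IsSum.of_map (hf : Function.Injective f) {X₁ Z₁ Y₁ T₁ X' Z' Y' T' : S}
    (h : (p.map f).IsSum (f X₁) (f Z₁) (f Y₁) (f T₁) (f X') (f Z') (f Y') (f T')) :
    p.IsSum X₁ Z₁ Y₁ T₁ X' Z' Y' T' := by
  obtain ⟨h1, h2, h3, h4⟩ := h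
  refine ⟨hf ?_, hf ?_, hf ?_, hf ?_⟩
  · simpa only [map_add, map_sub, map_mul, map_ofNat, map_x, map_y, map_s, map_A] using h1
  · simpa only [map_add, map_sub, map_mul, map_ofNat, map_x, map_y, map_s, map_A] using h2
  · simpa only [map_add, map_sub, map_mul, map_ofNat, map_x, map_y, map_s, map_A] using h3
  · simpa only [map_add, map_sub, map_mul, map_ofNat, map_x, map_y, map_s, map_A] using h4

/-- If the line `y = l x + m` meets the cubic at the abscissas `x₁`, `p.x` and `x₃`, then the
Edwards rules hold for the corresponding sum. The hypotheses compare the coefficients of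
`x³ + A x² + s² x - (l x + m)²` with those of `(x - x₁) (x - p.x) (x - x₃)`. -/
theorem isSum_of_line {x1 x3 l m : S} (hA : p.A = l ^ 2 - (x1 + p.x + x3))
    (hY : p.y = l * p.x + m) (hs : p.s ^ 2 = 2 * l * m + (x1 * p.x + x1 * x3 + p.x * x3))
    (hm : m ^ 2 = x1 * p.x * x3) :
    p.IsSum x1 (l * x1 + m) (x1 - p.s) (x1 + p.s) x3 (-(l * x3 + m)) (x3 - p.s) (x3 + p.s) := by
  rw [IsSum, hA, hY]
  generalize p.x = x2 at *
  -- The two sides of each rule differ by an element of the ideal generated by `hs` and `hm`; the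
  -- coefficients result from division by these two relations, with leading terms `s²` and `m²`.
  refine ⟨?_, ?_, ?_, ?_⟩
  · linear_combination (-2 * x1 * x2 * x3 * p.s - x1 * x2 * x3 ^ 2 + x1 * x2 ^ 2 * x3 + x1 ^ 2 *
      x2 * x3 + m ^ 2 * x3 - m ^ 2 * x2 - m ^ 2 * x1 - 2 * l * m * x1 * x2) * hs + (x2 * x3 * p.s
      + x2 * x3 ^ 2 - x2 ^ 2 * p.s - x2 ^ 2 * x3 + x1 * x3 * p.s + x1 * x3 ^ 2 + 2 * x1 * x2 * p.s
      - x1 ^ 2 * p.s - x1 ^ 2 * x3 + 2 * l * m * x3 - 2 * l * m * x2 - 2 * l * m * x1 - 4 * l ^ 2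
      * x1 * x2) * hm
  · linear_combination (2 * x1 * x2 * x3 * p.s + 2 * x1 * x2 ^ 2 * p.s + 2 * x1 ^ 2 * x2 * p.s -
      2 * m ^ 2 * p.s - 2 * l * m * x2 * p.s - 2 * l * m * x1 * p.s) * hs + (-4 * x1 * x2 * p.s -
      4 * l * m * p.s - 4 * l ^ 2 * x2 * p.s - 4 * l ^ 2 * x1 * p.s) * hm
  · linear_combination (2 * x1 * x2 * x3 * p.s - x1 * x2 * x3 ^ 2 + x1 * x2 ^ 2 * x3 + x1 ^ 2 *
      x2 * x3 + m ^ 2 * x3 - m ^ 2 * x2 - m ^ 2 * x1 - 2 * l * m * x1 * x2) * hs + (-x2 * x3 * p.s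
      + x2 * x3 ^ 2 + x2 ^ 2 * p.s - x2 ^ 2 * x3 - x1 * x3 * p.s + x1 * x3 ^ 2 - 2 * x1 * x2 * p.s
      + x1 ^ 2 * p.s - x1 ^ 2 * x3 + 2 * l * m * x3 - 2 * l * m * x2 - 2 * l * m * x1 - 4 * l ^ 2
      * x1 * x2) * hm
  · linear_combination (-2 * m * x2 * p.s + 2 * m * x1 * p.s) * hs + (-4 * l * x2 * p.s + 4 * l
      * x1 * p.s) * hm

variable (p)

/-- Two numerators of the Edwards abscissa `x / y` of `[n] p`, for the two denominators
`xDen`. The first pair is `(2 φ ψ : κ)`; both of its entries vanish where `φ = 0`, that is where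
`[n] p` is the point `(0, 0)` of the cubic. The second pair
`(κ ψ : 2 (φ² + A φ ψ² + s² ψ⁴))`, equivalent to the first by the equation of the cubic, is good
there. -/
def xNum (n : ℤ) : Bool → S
  | true => 2 * p.phi n * p.psi n
  | false => p.kappa n * p.psi n

/-- See `xNum`. -/
def xDen (n : ℤ) : Bool → S
  | true => p.kappa n
  | false => 2 * (p.phi n ^ 2 + p.A * p.phi n * p.psi n ^ 2 + p.s ^ 2 * p.psi n ^ 4)

/-- The numerator of the Edwards ordinate `(x - s) / (x + s)` of `[n] p`. -/
def yNum (n : ℤ) : S := p.phi n - p.s * p.psi n ^ 2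

/-- The denominator of the Edwards ordinate `(x - s) / (x + s)` of `[n] p`. -/
def yDen (n : ℤ) : S := p.phi n + p.s * p.psi n ^ 2

theorem map_xNum (n : ℤ) (i : Bool) : (p.map f).xNum n i = f (p.xNum n i) := by
  cases i <;> simp [xNum, map_phi, map_psi, map_kappa, map_ofNat]

theorem map_xDen (n : ℤ) (i : Bool) : (p.map f).xDen n i = f (p.xDen n i) := by
  cases i <;> simp [xDen, map_phi, map_psi, map_kappa, map_A, map_s, map_ofNat]

theorem map_yNum (n : ℤ) : (p.map f).yNum n = f (p.yNum n) := by
  simp [yNum, map_phi, map_psi, map_s]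

theorem map_yDen (n : ℤ) : (p.map f).yDen n = f (p.yDen n) := by
  simp [yDen, map_phi, map_psi, map_s]

theorem isSum_zero (i j : Bool) : p.IsSum (p.xNum 0 i) (p.xDen 0 i) (p.yNum 0) (p.yDen 0)
    (p.xNum 1 j) (p.xDen 1 j) (p.yNum 1) (p.yDen 1) := by
  have e := p.equation
  cases i <;> cases j <;>
    simp only [IsSum, xNum, xDen, yNum, yDen, phi_zero, psi_zero, kappa_zero, phi_one, psi_one,
      kappa_one] <;> refine ⟨?_, ?_, ?_, ?_⟩ <;> simp only [x, y, A, s] <;> ring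

end Ring

section Generic

open WeierstrassCurve.Affine

variable {L : Type*} [Field L] {p : MontgomeryPoint L}

theorem IsGeneric.phi_eq (hp : p.IsGeneric) {n : ℤ} (hn : 0 < n) :
    p.phi n = p.abscissa n * p.psi n ^ 2 := by
  have := hp.psi_ne_zero n hn
  rw [abscissa, phi]; field_simp

theorem IsGeneric.kappa_eq (hp : p.IsGeneric) {n : ℤ} (hn : 0 < n) :
    p.kappa n = 2 * p.ordinate n * p.psi n ^ 3 := by
  have := hp.psi_ne_zero n hn
  have := hp.two_ne_zero
  rw [ordinate]; field_simp

theorem IsGeneric.equation_coordinates (hp : p.IsGeneric) {n : ℕ} (hn : n ≠ 0) :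
    p.ordinate n ^ 2 =
      p.abscissa n ^ 3 + p.A * p.abscissa n ^ 2 + p.s ^ 2 * p.abscissa n := by
  classical
  obtain ⟨h, -⟩ := hp.hasCoordinates hn
  exact cubic_equation.1 h.1

theorem IsGeneric.kappa_sq (hp : p.IsGeneric) {n : ℕ} : p.kappa n ^ 2 =
    4 * p.phi n * (p.phi n ^ 2 + p.A * p.phi n * p.psi n ^ 2 + p.s ^ 2 * p.psi n ^ 4) := by
  rcases eq_or_ne n 0 with rfl | hn
  · simp; norm_num
  rw [hp.kappa_eq (by omega), hp.phi_eq (by omega)]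
  linear_combination (4 * p.psi n ^ 6) * hp.equation_coordinates hn

/-- Both pairs `(xNum : xDen)` are proportional to the coordinates of `[n] p`. -/
theorem IsGeneric.xNum_xDen (hp : p.IsGeneric) {n : ℕ} (hn : n ≠ 0) (i : Bool) :
    ∃ e, p.xNum n i = e * p.abscissa n ∧ p.xDen n i = e * p.ordinate n := by
  have hy : p.ordinate n ≠ 0 := by
    intro h
    apply hp.kappa_ne_zero (n := n) (by omega)
    rw [hp.kappa_eq (by omega), h]; ring
  have hx : p.abscissa n ≠ 0 := by
    intro h
    have := hp.equation_coordinates hn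
    rw [h] at this
    exact hy (pow_eq_zero_iff _root_.two_ne_zero |>.1 (by rw [this]; ring))
  have e := hp.equation_coordinates hn
  cases i
  · refine ⟨2 * p.psi n ^ 4 * (p.ordinate n / p.abscissa n), ?_, ?_⟩
    · rw [xNum, hp.kappa_eq (by omega)]; field_simp
    · rw [xDen, hp.phi_eq (by omega)]; field_simp; linear_combination (-2 * p.psi n ^ 4) * e
  · refine ⟨2 * p.psi n ^ 3, ?_, ?_⟩
    · rw [xNum, hp.phi_eq (by omega)]; ring
    · rw [xDen, hp.kappa_eq (by omega)]; ring

/-- The Edwards rules hold for the multiples of a generic point, as `[n] p`, `p` and `-[n + 1] p` are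
collinear. -/
theorem IsGeneric.isSum_coordinates (hp : p.IsGeneric) {n : ℕ} (hn : n ≠ 0) :
    p.IsSum (p.abscissa n) (p.ordinate n) (p.abscissa n - p.s) (p.abscissa n + p.s)
      (p.abscissa (n + 1 : ℕ)) (p.ordinate (n + 1 : ℕ)) (p.abscissa (n + 1 : ℕ) - p.s)
      (p.abscissa (n + 1 : ℕ) + p.s) := by
  classical
  obtain ⟨h0, e0⟩ := hp.hasCoordinates hn
  obtain ⟨h1, e1⟩ := hp.hasCoordinates (n := n + 1) (by omega)
  have eP := p.equation
  have eQ := hp.equation_coordinates hn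
  rw [succ_nsmul, e0] at e1
  rcases eq_or_ne n 1 with rfl | hn1
  · obtain ⟨g, k⟩ := hp.hasCoordinates_one
    rw [one_smul] at k
    have kX := (Point.some.inj k).1
    have kY := (Point.some.inj k).2
    have eP2 := hp.two_y_ne_zero
    obtain ⟨h2, e2⟩ := cubic_add_self (h₁ := hp.nonsingular) hp.two_y_ne_zero
    rw [← e0, one_smul] at e1
    have e3 := e2.symm.trans e1
    have jX := (Point.some.inj e3).1
    have jY := (Point.some.inj e3).2
    rw [← kX, ← kY, ← jY]
    rw [jX]
    -- The tangent at `p`.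
    set l := (3 * p.x ^ 2 + 2 * p.A * p.x + p.s ^ 2) / (2 * p.y) with hl
    have hl' : l * (2 * p.y) = 3 * p.x ^ 2 + 2 * p.A * p.x + p.s ^ 2 := div_mul_cancel₀ _ eP2
    set x3 := p.abscissa (1 + 1 : ℕ)
    have hs : p.s ^ 2 = 2 * l * (p.y - l * p.x) + (p.x * p.x + p.x * x3 + p.x * x3) := by
      rw [← jX]; linear_combination -hl'
    have hm : (p.y - l * p.x) ^ 2 = p.x * p.x * x3 := by
      rw [← jX]; linear_combination eP - p.x * hl'
    have := isSum_of_line (p := p) (x1 := p.x) (x3 := x3) (l := l) (m := p.y - l * p.x)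
      (by rw [← jX]; ring) (by ring) hs hm
    convert this using 1 <;> ring
  · have hx := hp.abscissa_sub_ne_zero (n := n) (by omega)
    obtain ⟨h2, e2⟩ := cubic_add_of_ne (h₁ := h0) (h₂ := hp.nonsingular) (sub_ne_zero.1 hx)
    have e3 := e2.symm.trans e1
    have jX := (Point.some.inj e3).1
    have jY := (Point.some.inj e3).2
    rw [← jY, jX]
    -- The chord through `[n] p` and `p`.
    set l := (p.ordinate n - p.y) / (p.abscissa n - p.x) with hl
    have hl' : l * (p.abscissa n - p.x) = p.ordinate n - p.y := div_mul_cancel₀ _ hx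
    set x3 := p.abscissa (n + 1 : ℕ)
    set x1 := p.abscissa n
    set y1 := p.ordinate n
    clear_value l
    have hs : p.s ^ 2 = 2 * l * (p.y - l * p.x) + (x1 * p.x + x1 * x3 + p.x * x3) := by
      apply mul_left_cancel₀ hx
      rw [← jX]
      linear_combination eP - eQ - (y1 + p.y + l * (x1 - p.x)) * hl'
    have hm : (p.y - l * p.x) ^ 2 = x1 * p.x * x3 := by
      have : x1 * p.x * x3 = p.x * (p.s ^ 2 - 2 * l * (p.y - l * p.x) - p.x * x1 - p.x * x3)  := by
        rw [hs]; ring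
      rw [this, ← jX]; linear_combination eP
    have := isSum_of_line (p := p) (x1 := x1) (x3 := x3) (l := l) (m := p.y - l * p.x)
      (by rw [← jX]; ring) (by ring) hs hm
    convert this using 1
    · linear_combination -hl'
    · linear_combination hl'

theorem IsGeneric.isSum (hp : p.IsGeneric) (n : ℕ) (i j : Bool) :
    p.IsSum (p.xNum n i) (p.xDen n i) (p.yNum n) (p.yDen n)
      (p.xNum (n + 1 : ℕ) j) (p.xDen (n + 1 : ℕ) j) (p.yNum (n + 1 : ℕ)) (p.yDen (n + 1 : ℕ)) := by
  rcases eq_or_ne n 0 with rfl | hn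
  · simpa using p.isSum_zero i j
  obtain ⟨e, he1, he2⟩ := hp.xNum_xDen hn i
  obtain ⟨e', he1', he2'⟩ := hp.xNum_xDen (n := n + 1) (by omega) j
  have h := (hp.isSum_coordinates hn).scale e (p.psi n ^ 2) e' (p.psi (n + 1 : ℕ) ^ 2)
  rw [he1, he2, he1', he2', yNum, yDen, yNum, yDen, hp.phi_eq (by omega), hp.phi_eq (by omega)]
  convert h using 1 <;> ring

/-- A Somos-4 relation for the division polynomials. -/
theorem IsGeneric.psi_somos (hp : p.IsGeneric) {n : ℕ} (hn : 2 ≤ n) :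
    p.psi (n + 2) * p.psi (n - 2) =
      (2 * p.y) ^ 2 * (p.psi (n + 1) * p.psi (n - 1)) - p.psiThree * p.psi n ^ 2 := by
  classical
  obtain ⟨m, rfl⟩ : ∃ m, n = m + 1 := ⟨n - 1, by omega⟩
  obtain ⟨n0, e0⟩ := hp.hasCoordinates (n := m) (by omega)
  obtain ⟨n1, e1⟩ := hp.hasCoordinates (n := m + 1) (by omega)
  obtain ⟨n2, e2⟩ := hp.hasCoordinates (n := m + 2) (by omega)
  have hx : p.abscissa (m + 1 : ℕ) - p.x ≠ 0 := hp.abscissa_sub_ne_zero (by push_cast; omega)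
  obtain ⟨na, ea⟩ := cubic_add_of_ne (h₁ := n1) (h₂ := hp.nonsingular) (sub_ne_zero.1 hx)
  obtain ⟨ys, ns, es⟩ := cubic_sub_of_ne (h₁ := n1) (h₂ := hp.nonsingular) (sub_ne_zero.1 hx)
  have fa : (m + 2) • hp.point = (m + 1) • hp.point + hp.point := by rw [← succ_nsmul]
  have fs : m • hp.point = (m + 1) • hp.point - hp.point := by rw [succ_nsmul, add_sub_cancel_right]
  have ga := ea.symm.trans ((by rw [e1]; rfl : _ = _ + hp.point).trans (fa.symm.trans e2))
  have gs := es.symm.trans ((by rw [e1]; rfl : _ = _ - hp.point).trans (fs.symm.trans e0))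
  have key := add_mul_sub_identity (cubic_equation.1 n1.1) p.equation hx
  rw [(Point.some.inj ga).1, (Point.some.inj gs).1] at key
  have z0 : p.psi m ≠ 0 := hp.psi_ne_zero _ (by omega)
  have z1 : p.psi (m + 1) ≠ 0 := hp.psi_ne_zero _ (by omega)
  have z2 : p.psi (m + 2) ≠ 0 := hp.psi_ne_zero _ (by omega)
  simp only [abscissa, Nat.cast_add, Nat.cast_one, Nat.cast_ofNat] at key ⊢
  simp only [show (m + 1 + 1 : ℤ) = m + 2 by ring, show (m + 1 - 1 : ℤ) = m by ring,
      show (m + 2 - 1 : ℤ) = m + 1 by ring, show (m + 1 + 2 : ℤ) = m + 2 + 1 by ring,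
      show (m + 1 - 2 : ℤ) = m - 1 by ring, sub_sub_cancel] at key ⊢
  rw [show 3 * p.x ^ 4 + 4 * p.A * p.x ^ 3 + 6 * p.s ^ 2 * p.x ^ 2 - (p.s ^ 2) ^ 2 = p.psiThree by
    rw [psiThree]; ring] at key
  field_simp at key
  linear_combination key

end Generic

end MontgomeryPoint

/-! ### Specialisation, common zeros and non-vanishing of the division polynomials -/

namespace MontgomeryPoint

section Points

variable {K : Type*} [Field K]

theorem exists_of_equation {A s x y : K} (hs : s ≠ 0) (hx : x ≠ 0)
    (h : y ^ 2 = x ^ 3 + A * x ^ 2 + s ^ 2 * x) :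
    ∃ p : MontgomeryPoint K, p.s = s ∧ p.A = A ∧ p.x = x ∧ p.y = y := by
  refine ⟨⟨x / s, s ^ 2 / x, y / x⟩, ?_, ?_, ?_, ?_⟩
  · simp only [MontgomeryPoint.s]; field_simp
  · simp only [MontgomeryPoint.A]; field_simp; linear_combination h
  · simp only [MontgomeryPoint.x]; field_simp
  · simp only [MontgomeryPoint.y]; field_simp

end Points

section DivisionPolynomials

open Polynomial

variable {K : Type*} [Field K] (A B : K)

theorem eval_twoSq (x : K) : ((cubic A B).Ψ₂Sq).eval x = 4 * (x ^ 3 + A * x ^ 2 + B * x) := by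
  simp [WeierstrassCurve.Ψ₂Sq, cubic, WeierstrassCurve.b₂, WeierstrassCurve.b₄,
    WeierstrassCurve.b₆]
  ring

theorem eval_three (x : K) : ((cubic A B).Ψ₃).eval x =
    3 * x ^ 4 + 4 * A * x ^ 3 + 6 * B * x ^ 2 - B ^ 2 := by
  simp [WeierstrassCurve.Ψ₃, cubic, WeierstrassCurve.b₂, WeierstrassCurve.b₄,
    WeierstrassCurve.b₆, WeierstrassCurve.b₈]
  ring

theorem eval_preFour (x : K) : ((cubic A B).preΨ₄).eval x =
    2 * x ^ 6 + 4 * A * x ^ 5 + 10 * B * x ^ 4 - 10 * B ^ 2 * x ^ 2 - 4 * A * B ^ 2 * x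
      - 2 * B ^ 3 := by
  simp [WeierstrassCurve.preΨ₄, cubic, WeierstrassCurve.b₂, WeierstrassCurve.b₄,
    WeierstrassCurve.b₆, WeierstrassCurve.b₈]
  ring

theorem eval_pre (x : K) (n : ℤ) : ((cubic A B).preΨ n).eval x =
    preNormEDS (((cubic A B).Ψ₂Sq.eval x) ^ 2) ((cubic A B).Ψ₃.eval x)
      ((cubic A B).preΨ₄.eval x) n := by
  rw [WeierstrassCurve.preΨ, ← coe_evalRingHom, map_preNormEDS, map_pow]

variable (p : MontgomeryPoint K)

theorem psi_eq_eval (n : ℤ) : p.psi n =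
    ((cubic p.A (p.s ^ 2)).preΨ n).eval p.x * if Even n then 2 * p.y else 1 := by
  rw [eval_pre, psi, normEDS, eval_twoSq, ← p.equation, eval_three, eval_preFour]
  congr 2
  · ring
  · rw [psiThree]; ring
  · rw [psiFour]; ring

theorem psi_sq_eq_eval (n : ℤ) : p.psi n ^ 2 = ((cubic p.A (p.s ^ 2)).ΨSq n).eval p.x := by
  have e := p.equation
  have h2 := eval_twoSq p.A (p.s ^ 2) p.x
  rw [psi_eq_eval, WeierstrassCurve.ΨSq]
  split_ifs
  · rw [eval_mul, eval_pow, h2, ← e]; ring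
  · simp

theorem phi_eq_eval (n : ℤ) : p.phi n = ((cubic p.A (p.s ^ 2)).Φ n).eval p.x := by
  have e := p.equation
  have h2 := eval_twoSq p.A (p.s ^ 2) p.x
  rw [phi, psi_sq_eq_eval, psi_eq_eval, psi_eq_eval, WeierstrassCurve.Φ]
  simp only [Int.even_add_one, Int.even_sub_one]
  split_ifs
  · simp
  · rw [eval_sub, eval_mul, eval_X, eval_mul, eval_mul, h2, ← e]; ring

/-- A nonzero polynomial in the abscissa is nonzero at some point of the curve outside the
`2`-torsion and the points with abscissa `-s`. -/
theorem exists_eval_ne_zero [IsAlgClosed K] (h2 : (2 : K) ≠ 0) {A s : K} (hs : s ≠ 0) {g : K[X]}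
    (hg : g ≠ 0) : ∃ p : MontgomeryPoint K, p.s = s ∧ p.A = A ∧ p.x ≠ 0 ∧ p.y ≠ 0 ∧
      p.x + p.s ≠ 0 ∧ g.eval p.x ≠ 0 := by
  have h4 : (4 : K) ≠ 0 := by rw [show (4 : K) = 2 * 2 by norm_num]; exact mul_ne_zero h2 h2
  have h0 : g * (Polynomial.X + C s) * (cubic A (s ^ 2)).Ψ₂Sq ≠ 0 :=
    mul_ne_zero (mul_ne_zero hg (X_add_C_ne_zero s)) (WeierstrassCurve.Ψ₂Sq_ne_zero _ h4)
  obtain ⟨x, hx⟩ : ∃ x, (g * (Polynomial.X + C s) * (cubic A (s ^ 2)).Ψ₂Sq).eval x ≠ 0 := by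
    by_contra! h
    exact h0 (Polynomial.funext (by simpa using h))
  rw [eval_mul, eval_mul, eval_twoSq, eval_add, eval_X, eval_C] at hx
  obtain ⟨y, hy⟩ := IsAlgClosed.exists_pow_nat_eq (x ^ 3 + A * x ^ 2 + s ^ 2 * x) two_pos
  have hx0 : x ≠ 0 := by rintro rfl; exact hx (by ring)
  have hy0 : y ≠ 0 := by
    rintro rfl
    exact hx (by rw [← hy]; ring)
  obtain ⟨p, e1, e2, e3, e4⟩ := exists_of_equation hs hx0 hy
  refine ⟨p, e1, e2, e3 ▸ hx0, e4 ▸ hy0, ?_, ?_⟩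
  · rw [e3, e1]; exact right_ne_zero_of_mul (left_ne_zero_of_mul hx)
  · rw [e3]; exact left_ne_zero_of_mul (left_ne_zero_of_mul hx)

end DivisionPolynomials

section Universal

/-- The universal point, over the polynomial ring in three variables. -/
noncomputable def universal : MontgomeryPoint (MvPolynomial (Fin 3) ℤ) :=
  ⟨MvPolynomial.X 0, MvPolynomial.X 1, MvPolynomial.X 2⟩

variable {S : Type*} [CommRing S] (p : MontgomeryPoint S)

/-- The specialisation of the universal point to a given one. -/
noncomputable def specialize : MvPolynomial (Fin 3) ℤ →+* S :=
  MvPolynomial.eval₂Hom (Int.castRingHom S) ![p.u, p.r, p.t]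

theorem universal_map_specialize : universal.map p.specialize = p := by
  simp [map, universal, specialize]

/-- No division polynomial vanishes at the universal point, since none vanishes identically on the
cubic `y² = x³ + x` in characteristic zero. -/
theorem universal_psi_ne_zero {n : ℤ} (hn : 0 < n) : universal.psi n ≠ 0 := by
  intro h
  have hg := WeierstrassCurve.preΨ_ne_zero (cubic (0 : AlgebraicClosure ℚ) (1 ^ 2)) (n := n)
    (by exact_mod_cast hn.ne')
  obtain ⟨p, e1, e2, -, hY, -, hp⟩ := exists_eval_ne_zero (A := 0) two_ne_zero one_ne_zero hg
  have h1 := p.psi_eq_eval n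
  rw [← universal_map_specialize p, map_psi, h, map_zero, universal_map_specialize, e1, e2] at h1
  refine mul_ne_zero hp ?_ h1.symm
  split_ifs
  · exact mul_ne_zero two_ne_zero hY
  · exact one_ne_zero

theorem universal_isGeneric :
    (universal.map (algebraMap _ (FractionRing (MvPolynomial (Fin 3) ℤ)))).IsGeneric where
  two_ne_zero := two_ne_zero
  psi_ne_zero n hn := by
    rw [map_psi]
    exact (map_ne_zero_iff _ (IsFractionRing.injective _ _)).2 (universal_psi_ne_zero hn)

/-- Both Edwards rules, wherever they are defined, compute `[n + 1] p` from `[n] p` and `p`. -/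
theorem isSum (n : ℕ) (i j : Bool) :
    p.IsSum (p.xNum n i) (p.xDen n i) (p.yNum n) (p.yDen n)
      (p.xNum (n + 1 : ℕ) j) (p.xDen (n + 1 : ℕ) j) (p.yNum (n + 1 : ℕ)) (p.yDen (n + 1 : ℕ)) := by
  have h := universal_isGeneric.isSum n i j
  simp only [map_xNum, map_xDen, map_yNum, map_yDen] at h
  have h := (IsSum.of_map _ (IsFractionRing.injective _ _) h).map p.specialize
  simpa only [← map_xNum, ← map_xDen, ← map_yNum, ← map_yDen, universal_map_specialize] using h

/-- The equation of the cubic for `[n] p`. -/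
theorem kappa_sq (n : ℕ) : p.kappa n ^ 2 =
    4 * p.phi n * (p.phi n ^ 2 + p.A * p.phi n * p.psi n ^ 2 + p.s ^ 2 * p.psi n ^ 4) := by
  have h := universal_isGeneric.kappa_sq (n := n)
  simp only [map_kappa, map_phi, map_psi, map_A, map_s] at h
  have h : universal.kappa n ^ 2 = 4 * universal.phi n * (universal.phi n ^ 2 +
      universal.A * universal.phi n * universal.psi n ^ 2 +
        universal.s ^ 2 * universal.psi n ^ 4) :=
    IsFractionRing.injective _ (FractionRing (MvPolynomial (Fin 3) ℤ))
      (by simpa [map_ofNat] using h)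
  rw [← universal_map_specialize p]
  simp only [map_kappa, map_phi, map_psi, map_A, map_s]
  simpa [map_ofNat] using congrArg p.specialize h

theorem psi_somos {n : ℕ} (hn : 2 ≤ n) : p.psi (n + 2) * p.psi (n - 2) =
    (2 * p.y) ^ 2 * (p.psi (n + 1) * p.psi (n - 1)) - p.psiThree * p.psi n ^ 2 := by
  have h := universal_isGeneric.psi_somos hn
  simp only [map_psi, map_psiThree, map_y] at h
  have h : universal.psi (n + 2) * universal.psi (n - 2) = (2 * universal.y) ^ 2 *
      (universal.psi (n + 1) * universal.psi (n - 1)) - universal.psiThree * universal.psi n ^ 2 :=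
    IsFractionRing.injective _ (FractionRing (MvPolynomial (Fin 3) ℤ))
      (by simpa [map_ofNat] using h)
  rw [← universal_map_specialize p]
  simp only [map_psi, map_psiThree, map_y]
  simpa [map_ofNat] using congrArg p.specialize h

end Universal

section Coprime

variable {K : Type*} [Field K] {p : MontgomeryPoint K}

/-- A point outside the `2`-torsion of order dividing three does not have order dividing four. -/
theorem psiFour_ne_zero (h2 : 2 * p.y ≠ 0) (h3 : p.psiThree = 0) : p.psiFour ≠ 0 := by
  intro h4
  have h : p.psiFour = 2 * (3 * p.x ^ 2 + 2 * p.A * p.x + p.s ^ 2) * p.psiThree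
      - (2 * p.y) ^ 4 := by
    rw [show (2 * p.y) ^ 4 = 16 * (p.y ^ 2) ^ 2 by ring, p.equation, psiThree, psiFour]; ring
  rw [h4, h3] at h
  exact pow_ne_zero 4 h2 (by linear_combination h)

/-- At a point of order three, the zeros of the division polynomials are the multiples of
three. -/
theorem psi_eq_zero_iff_of_psiThree (h2 : 2 * p.y ≠ 0) (h3 : p.psiThree = 0) (n : ℕ) :
    p.psi n = 0 ↔ 3 ∣ n := by
  have h4 := psiFour_ne_zero h2 h3
  induction n using normEDSRec with
  | zero => simp
  | one => simp
  | two => simpa [psi_two] using h2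
  | three => simp [psi_three, h3]
  | four => simpa [psi_four, h4] using h2
  | even m i1 i2 i3 i4 i5 =>
    have h := p.psi_even (m + 3 : ℕ)
    push_cast at h i1 i2 i3 i4 i5 ⊢
    rw [show (m + 3 + 2 : ℤ) = m + 5 by ring, show (m + 3 - 1 : ℤ) = m + 2 by ring,
      show (m + 3 - 2 : ℤ) = m + 1 by ring, show (m + 3 + 1 : ℤ) = m + 4 by ring] at h
    rw [← mul_left_inj' h2, zero_mul, h]
    obtain hm | hm | hm : m % 3 = 0 ∨ m % 3 = 1 ∨ m % 3 = 2 := by omega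
    · rw [i3.2 (by omega)]; simp; omega
    · rw [i2.2 (by omega), i5.2 (by omega)]
      have := mt i1.1 (by omega)
      have := mt i3.1 (by omega)
      have := mt i4.1 (by omega)
      simp [*]; omega
    · rw [i1.2 (by omega), i4.2 (by omega)]
      have := mt i2.1 (by omega)
      have := mt i3.1 (by omega)
      have := mt i5.1 (by omega)
      simp [*]; omega
  | odd m i1 i2 i3 i4 =>
    have h := p.psi_odd (m + 2 : ℕ)
    push_cast at h i1 i2 i3 i4 ⊢
    rw [show (m + 2 + 2 : ℤ) = m + 4 by ring, show (m + 2 - 1 : ℤ) = m + 1 by ring,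
      show (m + 2 + 1 : ℤ) = m + 3 by ring] at h
    rw [h]
    obtain hm | hm | hm : m % 3 = 0 ∨ m % 3 = 1 ∨ m % 3 = 2 := by omega
    · rw [i3.2 (by omega)]
      have := mt i2.1 (by omega)
      have := mt i4.1 (by omega)
      simp [*]; omega
    · rw [i2.2 (by omega)]
      have := mt i1.1 (by omega)
      have := mt i3.1 (by omega)
      simp [*]; omega
    · rw [i1.2 (by omega), i4.2 (by omega)]; simp; omega

/-- Two consecutive division polynomials have no common zero outside the `2`-torsion. At the first
such pair, the Somos-4 relation would force the third division polynomial to vanish, in which case the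
zeros are known. -/
theorem psi_ne_zero_or (h2 : 2 * p.y ≠ 0) (n : ℕ) : p.psi n ≠ 0 ∨ p.psi (n + 1 : ℕ) ≠ 0 := by
  induction n with
  | zero => simp
  | succ n ih =>
    by_contra! h
    have hn := ih.resolve_right (not_not.2 h.1)
    obtain _ | _ | n := n
    · simp at hn
    · exact h2 (by simpa [psi_two] using h.1)
    have e := p.psi_somos (n := n + 2) (by omega)
    have h1 := h.1
    have h1' := h.2
    push_cast at h1 h1' e hn
    rw [show (n + 1 + 1 + 1 : ℤ) = n + 2 + 1 by ring] at h1
    rw [show (n + 1 + 1 + 1 + 1 : ℤ) = n + 2 + 2 by ring] at h1'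
    rw [show (n + 1 + 1 : ℤ) = n + 2 by ring] at hn
    rw [h1, h1'] at e
    have h3 : p.psiThree = 0 := by
      have : p.psiThree * p.psi (n + 2) ^ 2 = 0 := by linear_combination e
      exact (mul_eq_zero.1 this).resolve_right (pow_ne_zero 2 hn)
    have k1 := (psi_eq_zero_iff_of_psiThree h2 h3 _).1 h.1
    have k2 := (psi_eq_zero_iff_of_psiThree h2 h3 _).1 h.2
    omega

/-- The functions `phi n` and `psi n` have no common zero outside the `2`-torsion. -/
theorem phi_ne_zero_of_psi (h2 : 2 * p.y ≠ 0) {n : ℕ} (h : p.psi n = 0) : p.phi n ≠ 0 := by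
  obtain _ | n := n
  · simp
  have a1 := (psi_ne_zero_or h2 n).resolve_right (not_not.2 h)
  have a2 := (psi_ne_zero_or h2 (n + 1)).resolve_left (not_not.2 h)
  rw [phi, h]
  push_cast at a2 ⊢
  rw [show (n + 1 - 1 : ℤ) = n by ring]
  simp [a1, a2]

end Coprime

section NonVanishing

open Polynomial

variable {K : Type*} [Field K]

/-- A normalised elliptic divisibility sequence with second term zero and third term nonzero
vanishes exactly at the even indices. -/
theorem normEDS_zero_ne_zero {c d : K} (hc : c ≠ 0) (n : ℕ) :
    (Even n → normEDS 0 c d n = 0) ∧ (Odd n → normEDS 0 c d n ≠ 0) := by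
  have he : ∀ k : ℤ, Even k → normEDS 0 c d k = 0 := fun k hk => by simp [normEDS, hk]
  refine ⟨fun h => he n (by exact_mod_cast h), ?_⟩
  induction n using normEDSRec with
  | zero => simp
  | one => simp
  | two => simp
  | three => rw [Nat.cast_ofNat, normEDS_three]; exact fun _ => hc
  | four => exact fun h => absurd h (by decide)
  | even m _ _ _ _ _ => exact fun h => absurd h (by simp)
  | odd m i1 i2 i3 i4 =>
    intro _
    have h := normEDS_odd 0 c d (m + 2 : ℕ)
    push_cast at h i1 i2 i3 i4 ⊢
    rw [show (m + 2 + 2 : ℤ) = m + 4 by ring, show (m + 2 - 1 : ℤ) = m + 1 by ring,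
      show (m + 2 + 1 : ℤ) = m + 3 by ring] at h
    rw [h]
    rcases Nat.even_or_odd m with hm | hm
    · have a2 := he (m + 2) (by obtain ⟨k, rfl⟩ := hm; exact ⟨k + 1, by push_cast; ring⟩)
      have := i1 (by grind)
      have := i3 (by grind)
      simp [*]
    · have a1 := he (m + 1) (by obtain ⟨k, rfl⟩ := hm; exact ⟨k + 1, by push_cast; ring⟩)
      have := i2 (by grind)
      have := i4 (by grind)
      simp [*]

/-- At the `2`-torsion, the division polynomials of odd index do not vanish. -/
theorem eval_pre_ne_zero {A s x : K} (hs : s ≠ 0) (hA : A ^ 2 - 4 * s ^ 2 ≠ 0)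
    (hx : x ^ 3 + A * x ^ 2 + s ^ 2 * x = 0) {n : ℕ} (hn : Odd n) :
    ((cubic A (s ^ 2)).preΨ n).eval x ≠ 0 := by
  have hc : (cubic A (s ^ 2)).Ψ₃.eval x ≠ 0 := by
    have e : (cubic A (s ^ 2)).Ψ₃.eval x = -(3 * x ^ 2 + 2 * A * x + s ^ 2) ^ 2 := by
      rw [eval_three]; linear_combination (4 * A + 12 * x) * hx
    rw [e]
    refine neg_ne_zero.2 (pow_ne_zero 2 fun h => ?_)
    rcases eq_or_ne x 0 with rfl | hx0
    · exact pow_ne_zero 2 hs (by linear_combination h)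
    have q : x ^ 2 + A * x + s ^ 2 = 0 := mul_left_cancel₀ hx0 (by linear_combination hx)
    have l : 2 * x + A = 0 := mul_left_cancel₀ hx0 (by linear_combination h - q)
    exact hA (by linear_combination (2 * x + A) * l - 4 * q)
  have h := (normEDS_zero_ne_zero (d := (cubic A (s ^ 2)).preΨ₄.eval x) hc n).2 hn
  rw [eval_pre, eval_twoSq, hx]
  rwa [normEDS, if_neg (by exact_mod_cast Nat.not_even_iff_odd.2 hn), mul_one,
    show (0 : K) ^ 4 = (4 * 0) ^ 2 by ring] at h

/-- The division polynomials of a nonsingular cubic do not vanish identically, also where the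
index is divisible by the characteristic. For even `n`, the polynomial `Φ n` is monic of positive
degree; at one of its roots the division polynomial is nonzero, as the two have no common root. -/
theorem pre_ne_zero [IsAlgClosed K] {A s : K} (h2 : (2 : K) ≠ 0) (hs : s ≠ 0)
    (hA : A ^ 2 - 4 * s ^ 2 ≠ 0) {n : ℕ} (hn : n ≠ 0) : (cubic A (s ^ 2)).preΨ n ≠ 0 := by
  intro h0
  rcases Nat.even_or_odd n with he | ho
  swap
  · refine eval_pre_ne_zero hs hA (x := 0) (by ring) ho ?_
    rw [h0, eval_zero]
  have hdeg := WeierstrassCurve.natDegree_Φ (cubic A (s ^ 2)) n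
  obtain ⟨x, hx⟩ := IsAlgClosed.exists_root ((cubic A (s ^ 2)).Φ n) (by
    intro h
    rw [natDegree_eq_of_degree_eq_some h] at hdeg
    exact pow_ne_zero 2 (Int.natAbs_ne_zero.2 (Nat.cast_ne_zero.2 hn)) hdeg.symm)
  rw [IsRoot] at hx
  have hf : x ^ 3 + A * x ^ 2 + s ^ 2 * x ≠ 0 := by
    intro hf
    obtain ⟨m, rfl⟩ : ∃ m, n = m + 1 := ⟨n - 1, by omega⟩
    have a1 := eval_pre_ne_zero hs hA hf (n := m + 2) (by grind)
    have a2 := eval_pre_ne_zero hs hA hf (n := m) (by grind)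
    have he' : Even ((m + 1 : ℕ) : ℤ) := by exact_mod_cast he
    rw [WeierstrassCurve.Φ, WeierstrassCurve.ΨSq, h0, if_pos he', if_pos he',
      show ((m + 1 : ℕ) + 1 : ℤ) = (m + 2 : ℕ) by push_cast; ring,
      show ((m + 1 : ℕ) - 1 : ℤ) = m by push_cast; ring, eval_sub, eval_mul, eval_mul,
      eval_mul] at hx
    exact mul_ne_zero a1 a2 (by simpa using hx)
  have hx0 : x ≠ 0 := by rintro rfl; exact hf (by ring)
  obtain ⟨y, hy⟩ := IsAlgClosed.exists_pow_nat_eq (x ^ 3 + A * x ^ 2 + s ^ 2 * x) two_pos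
  obtain ⟨p, rfl, rfl, rfl, rfl⟩ := exists_of_equation hs hx0 hy
  have hY : 2 * p.y ≠ 0 := by
    refine mul_ne_zero h2 fun h => hf ?_
    rw [← hy, h]; ring
  refine phi_ne_zero_of_psi hY (n := n) ?_ ?_
  · rw [psi_eq_eval, h0, eval_zero, zero_mul]
  · rw [phi_eq_eval, hx]

/-- The denominator of the Edwards ordinate of `[n] p`, as a polynomial in the abscissa, is nonzero:
`Φ n` is monic of degree `n²`, and the degree of `ΨSq n` is smaller. -/
theorem yDen_polynomial_ne_zero {A s : K} {n : ℕ} (hn : n ≠ 0) :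
    (cubic A (s ^ 2)).Φ n + C s * (cubic A (s ^ 2)).ΨSq n ≠ 0 := by
  intro h
  have h1 := WeierstrassCurve.coeff_Φ (cubic A (s ^ 2)) n
  have h2 : ((cubic A (s ^ 2)).ΨSq n).coeff (Int.natAbs n ^ 2) = 0 := by
    refine coeff_eq_zero_of_natDegree_lt ((WeierstrassCurve.natDegree_ΨSq_le _ _).trans_lt ?_)
    have : 0 < (Int.natAbs n) ^ 2 := pow_pos (by omega) 2
    omega
  have h3 := congrArg (fun q => q.coeff (Int.natAbs n ^ 2)) h
  simp only [coeff_add, coeff_C_mul, h2, h1, mul_zero, add_zero, coeff_zero] at h3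
  exact one_ne_zero h3

end NonVanishing

end MontgomeryPoint

/-! ### The projective line, completeness of the addition rules, and values of rational functions -/

namespace TwistedEdwardsCurve

section ProjectiveLine

variable {F : Type*} [Field F]

@[simp] theorem num_some (c : F) : num (OnePoint.some c) = c := rfl
@[simp] theorem den_some (c : F) : den (OnePoint.some c) = 1 := rfl
@[simp] theorem num_infty : num (OnePoint.infty : OnePoint F) = 1 := rfl
@[simp] theorem den_infty : den (OnePoint.infty : OnePoint F) = 0 := rfl

theorem exists_eq_mul_ratio {s t : F} (h : s ≠ 0 ∨ t ≠ 0) :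
    ∃ e, e ≠ 0 ∧ s = e * num (ratio s t) ∧ t = e * den (ratio s t) := by
  by_cases ht : t = 0
  · exact ⟨s, by simpa [ht] using h, by simp [ratio, ht], by simp [ratio, ht]⟩
  · refine ⟨t, ht, ?_, ?_⟩
    · simp only [ratio, ht, if_false, num_some]; field_simp
    · simp [ratio, ht]

/-- A point of the projective line is determined by proportional homogeneous coordinates. -/
theorem eq_ratio {z : OnePoint F} {s t : F} (h : s ≠ 0 ∨ t ≠ 0) (hz : num z * t = den z * s) :
    z = ratio s t := by
  induction z using OnePoint.rec with
  | infty =>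
    have : t = 0 := by simpa using hz
    simp [ratio, this]
  | coe c =>
    have hz : c * t = s := by simpa using hz
    have ht : t ≠ 0 := by
      rintro rfl
      simp [← hz] at h
    simp only [ratio, ht, if_false]
    rw [eq_div_of_mul_eq ht hz]

end ProjectiveLine

section Completeness

variable {F : Type*} [Field F] (E : TwistedEdwardsCurve F)

/-- On the completion, if one coordinate of the first addition rule is undefined at a pair of
points, the second of which is affine with `x ≠ 0`, then the second rule is defined there. -/
theorem second_rule_defined {x y : F} (hx : x ≠ 0) (h : E.Equation x y)
    (P : OnePoint F × OnePoint F) (hP : E.a * num P.1 ^ 2 * den P.2 ^ 2 + num P.2 ^ 2 * den P.1 ^ 2 =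
      den P.1 ^ 2 * den P.2 ^ 2 + E.d * num P.1 ^ 2 * num P.2 ^ 2)
    (hf : ¬((num P.1 * y * den P.2 + x * num P.2 * den P.1 ≠ 0 ∨
        den P.1 * den P.2 + E.d * num P.1 * x * num P.2 * y ≠ 0) ∧
      (num P.2 * y * den P.1 - E.a * num P.1 * x * den P.2 ≠ 0 ∨
        den P.1 * den P.2 - E.d * num P.1 * x * num P.2 * y ≠ 0))) :
    (num P.1 * num P.2 + x * y * den P.1 * den P.2 ≠ 0 ∨
        E.a * num P.1 * x * den P.2 + num P.2 * y * den P.1 ≠ 0) ∧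
      (num P.1 * num P.2 - x * y * den P.1 * den P.2 ≠ 0 ∨
        num P.1 * y * den P.2 - x * num P.2 * den P.1 ≠ 0) := by
  have ha := E.a_ne_zero
  have hd := E.d_ne_zero
  have h2 := E.two_ne_zero
  obtain ⟨U, V⟩ := P
  induction U using OnePoint.rec with
  | infty =>
    induction V using OnePoint.rec with
    | infty => exact absurd (by simpa using hP : 0 = E.d).symm hd
    | coe y₁ =>
      have hy : y₁ ≠ 0 := by rintro rfl; simp [ha] at hP
      simp [hy]
  | coe x₁ =>
    induction V using OnePoint.rec with
    | infty =>
      have hx₁ : x₁ ≠ 0 := by rintro rfl; simp at hP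
      simp [hx₁]
    | coe y₁ =>
      simp only [num_some, den_some, mul_one, one_pow] at hP hf ⊢
      -- The common degenerate case: `d x² y² = 1` and `a x² = y²` force `a = d`.
      have key : E.d * x ^ 2 * y ^ 2 = 1 → E.a * x ^ 2 = y ^ 2 → False := by
        intro e1 e2
        have e3 : y ^ 2 = 1 := by
          refine mul_left_cancel₀ h2 ?_
          rw [Equation] at h
          linear_combination h - e2 + e1
        refine E.a_ne_d (mul_right_cancel₀ (pow_ne_zero 2 hx) ?_)
        rw [e3, mul_one] at e1
        rw [e1, e2, e3]
      by_contra hg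
      have hz : ∀ ε : F, ε ≠ 0 → E.d * x₁ * x * y₁ * y = ε → x₁ ≠ 0 ∧ y₁ ≠ 0 ∧ y ≠ 0 := by
        rintro ε hε h
        refine ⟨?_, ?_, ?_⟩ <;> rintro rfl <;> exact hε (by rw [← h]; ring)
      rw [not_and_or] at hf hg
      push Not at hf hg
      rcases hf with ⟨f1, f2⟩ | ⟨f1, f2⟩
      · obtain ⟨z1, z2, z3⟩ := hz (-1) (by simp) (by linear_combination f2)
        rcases hg with ⟨g1, g2⟩ | ⟨g1, g2⟩
        · refine key ?_ ?_
          · linear_combination (E.d * x * y) * g1 - f2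
          · have : x₁ * (E.a * x ^ 2 - y ^ 2) = 0 := by
              linear_combination x * g2 - y * f1
            linear_combination (mul_eq_zero.1 this).resolve_left z1
        · refine mul_ne_zero h2 (mul_ne_zero z1 z3) ?_
          linear_combination f1 + g2
      · obtain ⟨z1, z2, z3⟩ := hz 1 (by simp) (by linear_combination -f2)
        rcases hg with ⟨g1, g2⟩ | ⟨g1, g2⟩
        · refine mul_ne_zero h2 (mul_ne_zero z2 z3) ?_
          linear_combination f1 + g2
        · refine key ?_ ?_
          · linear_combination -(E.d * x * y) * g1 - f2
          · have : x₁ * (E.a * x ^ 2 - y ^ 2) = 0 := by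
              linear_combination -x * f1 - y * g2
            linear_combination (mul_eq_zero.1 this).resolve_left z1

end Completeness

section Values

variable {F : Type*} [Field F] (E : TwistedEdwardsCurve F) {x y : F}

variable {E} in
theorem hasValue_some_iff {f : E.FunctionField} {c : F} :
    E.HasValue f x y (OnePoint.some c) ↔ ∃ p q : F[X][Y], q.evalEval x y ≠ 0 ∧
      f * E.toFunctionField q = E.toFunctionField p ∧ p.evalEval x y = c * q.evalEval x y := by
  constructor
  · rintro ⟨p, q, -, h, hc⟩
    by_cases hq : q.evalEval x y = 0
    · simp [ratio, hq] at hc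
    · simp only [ratio, hq, if_false] at hc
      refine ⟨p, q, hq, h, ?_⟩
      rw [OnePoint.coe_injective hc, div_mul_cancel₀ _ hq]
  · rintro ⟨p, q, hq, h, hc⟩
    refine ⟨p, q, Or.inr hq, h, ?_⟩
    simp [ratio, hq, hc]

theorem evalEval_eq_zero (h : E.Equation x y) {p : F[X][Y]} (hp : E.toFunctionField p = 0) :
    p.evalEval x y = 0 := by
  have h1 : AdjoinRoot.mk E.polynomial p = 0 :=
    (map_eq_zero_iff _ (IsFractionRing.injective E.CoordinateRing E.FunctionField)).1 hp
  obtain ⟨q, rfl⟩ := AdjoinRoot.mk_eq_zero.1 h1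
  rw [Equation] at h
  have : E.polynomial.evalEval x y = 0 := by
    simp [polynomial, Polynomial.evalEval]
    linear_combination h
  rw [Polynomial.evalEval_mul, this, zero_mul]

variable {E}

theorem HasValue.eq (h : E.Equation x y) {f : E.FunctionField} {c c' : F}
    (hc : E.HasValue f x y (OnePoint.some c)) (hc' : E.HasValue f x y (OnePoint.some c')) :
    c = c' := by
  obtain ⟨p, q, hq, e, v⟩ := hasValue_some_iff.1 hc
  obtain ⟨p', q', hq', e', v'⟩ := hasValue_some_iff.1 hc'
  have := E.evalEval_eq_zero h (p := p * q' - p' * q) (by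
    rw [map_sub, map_mul, map_mul, ← e, ← e']; ring)
  rw [Polynomial.evalEval_sub, Polynomial.evalEval_mul, Polynomial.evalEval_mul, v, v'] at this
  exact mul_right_cancel₀ (mul_ne_zero hq hq') (by linear_combination this)

theorem hasValue_polynomial (p : F[X][Y]) :
    E.HasValue (E.toFunctionField p) x y (OnePoint.some (p.evalEval x y)) :=
  hasValue_some_iff.2 ⟨p, 1, by simp, by simp, by simp⟩

theorem HasValue.add {f g : E.FunctionField} {c c' : F}
    (hf : E.HasValue f x y (OnePoint.some c)) (hg : E.HasValue g x y (OnePoint.some c')) :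
    E.HasValue (f + g) x y (OnePoint.some (c + c')) := by
  obtain ⟨p, q, hq, e, v⟩ := hasValue_some_iff.1 hf
  obtain ⟨p', q', hq', e', v'⟩ := hasValue_some_iff.1 hg
  refine hasValue_some_iff.2 ⟨p * q' + p' * q, q * q', ?_, ?_, ?_⟩
  · rw [Polynomial.evalEval_mul]; exact mul_ne_zero hq hq'
  · simp only [map_add, map_mul, ← e, ← e']; ring
  · simp only [Polynomial.evalEval_add, Polynomial.evalEval_mul, v, v']; ring

theorem HasValue.mul {f g : E.FunctionField} {c c' : F}
    (hf : E.HasValue f x y (OnePoint.some c)) (hg : E.HasValue g x y (OnePoint.some c')) :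
    E.HasValue (f * g) x y (OnePoint.some (c * c')) := by
  obtain ⟨p, q, hq, e, v⟩ := hasValue_some_iff.1 hf
  obtain ⟨p', q', hq', e', v'⟩ := hasValue_some_iff.1 hg
  refine hasValue_some_iff.2 ⟨p * p', q * q', ?_, ?_, ?_⟩
  · rw [Polynomial.evalEval_mul]; exact mul_ne_zero hq hq'
  · simp only [map_mul, ← e, ← e']; ring
  · simp only [Polynomial.evalEval_mul, v, v']; ring

theorem HasValue.neg {f : E.FunctionField} {c : F} (hf : E.HasValue f x y (OnePoint.some c)) :
    E.HasValue (-f) x y (OnePoint.some (-c)) := by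
  obtain ⟨p, q, hq, e, v⟩ := hasValue_some_iff.1 hf
  refine hasValue_some_iff.2 ⟨-p, q, hq, ?_, ?_⟩
  · rw [map_neg, ← e]; ring
  · rw [Polynomial.evalEval_neg, v]; ring

/-- A rational function that satisfies `f * g = h` takes the value `(h : g)`, unless both `g` and
`h` vanish. -/
theorem HasValue.of_mul_eq {f g h : E.FunctionField} {c e : F}
    (hg : E.HasValue g x y (OnePoint.some c)) (hh : E.HasValue h x y (OnePoint.some e))
    (hf : f * g = h) (hec : e ≠ 0 ∨ c ≠ 0) : E.HasValue f x y (ratio e c) := by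
  obtain ⟨p, q, hq, k, v⟩ := hasValue_some_iff.1 hg
  obtain ⟨p', q', hq', k', v'⟩ := hasValue_some_iff.1 hh
  refine ⟨p' * q, p * q', ?_, ?_, ?_⟩
  · simp only [Polynomial.evalEval_mul, v, v']
    exact hec.imp (fun h => by simp [*]) fun h => by simp [*]
  · simp only [map_mul, ← k, ← k', ← hf]; ring
  · simp only [Polynomial.evalEval_mul, v, v']
    refine eq_ratio (hec.imp (fun h => by simp [*]) fun h => by simp [*]) ?_
    obtain ⟨l, hl, h1, h2⟩ := exists_eq_mul_ratio hec
    refine mul_left_cancel₀ hl ?_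
    linear_combination (-(c * q.evalEval x y * q'.evalEval x y)) * h1 +
      (e * q.evalEval x y * q'.evalEval x y) * h2

theorem HasValue.div {f g : E.FunctionField} {c c' : F} (h : E.Equation x y)
    (hf : E.HasValue f x y (OnePoint.some c)) (hg : E.HasValue g x y (OnePoint.some c'))
    (hc : c' ≠ 0) : E.HasValue (f / g) x y (OnePoint.some (c / c')) := by
  have hg0 : g ≠ 0 := by
    rintro rfl
    exact hc (hg.eq h (by simpa using hasValue_polynomial (E := E) (x := x) (y := y) 0))
  have := HasValue.of_mul_eq hg hf (div_mul_cancel₀ f hg0) (Or.inr hc)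
  simpa [ratio, hc] using this

variable (E x y) in
/-- The rational functions that are regular at `(x, y)`, together with their values there. -/
def values : Subring (E.FunctionField × F) where
  carrier := {f | E.HasValue f.1 x y (OnePoint.some f.2)}
  mul_mem' hf hg := HasValue.mul hf hg
  one_mem' := by simpa using hasValue_polynomial (E := E) (x := x) (y := y) 1
  add_mem' hf hg := HasValue.add hf hg
  zero_mem' := by simpa using hasValue_polynomial (E := E) (x := x) (y := y) 0
  neg_mem' hf := HasValue.neg hf

theorem hasValue_const (c : F) : E.HasValue (E.const c) x y (OnePoint.some c) := by
  simpa [const, Polynomial.evalEval] using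
    hasValue_polynomial (E := E) (x := x) (y := y) (Polynomial.C (Polynomial.C c))

theorem hasValue_xFun : E.HasValue E.xFun x y (OnePoint.some x) := by
  simpa [xFun, Polynomial.evalEval] using
    hasValue_polynomial (E := E) (x := x) (y := y) (Polynomial.C Polynomial.X)

theorem hasValue_yFun : E.HasValue E.yFun x y (OnePoint.some y) := by
  simpa [yFun, Polynomial.evalEval] using
    hasValue_polynomial (E := E) (x := x) (y := y) Polynomial.X

end Values

end TwistedEdwardsCurve

/-! ### From the Edwards curve to the cubic -/

/-- The point of a Montgomery cubic that corresponds to the point `(x, y)` of the twisted Edwards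
curve with parameters `a` and `d`. It has `s = (a - d) / 4` and `A = (a + d) / 2`,
its abscissa is `s (1 + y) / (1 - y)`, and its ordinate is the abscissa divided by `x`. -/
def MontgomeryPoint.ofEdwards {F : Type*} [Field F] (a d x y : F) : MontgomeryPoint F :=
  ⟨(1 + y) / (1 - y), (a - d) / 4 * ((1 - y) / (1 + y)), 1 / x⟩

namespace MontgomeryPoint

variable {F : Type*} [Field F] {a d x y : F}

theorem ofEdwards_x (hy' : 1 + y ≠ 0) :
    (ofEdwards a d x y).x = (a - d) / 4 * ((1 + y) / (1 - y)) := by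
  rcases eq_or_ne (1 - y) 0 with h | h
  · simp [MontgomeryPoint.x, ofEdwards, h]
  · simp only [MontgomeryPoint.x, ofEdwards]; field_simp

theorem ofEdwards_s (hy : 1 - y ≠ 0) (hy' : 1 + y ≠ 0) :
    (ofEdwards a d x y).s = (a - d) / 4 := by
  simp only [s, ofEdwards]; field_simp

theorem ofEdwards_y : (ofEdwards a d x y).y = (ofEdwards a d x y).x / x := by
  simp only [MontgomeryPoint.y, MontgomeryPoint.x, ofEdwards]; ring

theorem ofEdwards_A (h2 : (2 : F) ≠ 0) (h : a * x ^ 2 + y ^ 2 = 1 + d * x ^ 2 * y ^ 2) (hx : x ≠ 0)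
    (hy : 1 - y ≠ 0) (hy' : 1 + y ≠ 0) : (ofEdwards a d x y).A = (a + d) / 2 := by
  have h4 : (4 : F) = 2 * 2 := by norm_num
  simp only [A, ofEdwards, h4]
  field_simp
  linear_combination -4 * h

end MontgomeryPoint

namespace TwistedEdwardsCurve

section Affine

variable {F : Type*} [Field F] (E : TwistedEdwardsCurve F) {x y : F}

theorem four_ne_zero (E : TwistedEdwardsCurve F) : (4 : F) ≠ 0 := by
  rw [show (4 : F) = 2 * 2 by norm_num]; exact mul_ne_zero E.two_ne_zero E.two_ne_zero

theorem s_ne_zero : (E.a - E.d) / 4 ≠ 0 :=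
  div_ne_zero (sub_ne_zero.2 E.a_ne_d) E.four_ne_zero

theorem one_sub_mul_one_add (h : E.Equation x y) :
    (1 - y) * (1 + y) = x ^ 2 * (E.a - E.d * y ^ 2) := by
  rw [Equation] at h; linear_combination -h

theorem Equation.y_ne {E : TwistedEdwardsCurve F} (h : E.Equation x y) (hx : x ≠ 0) :
    1 - y ≠ 0 ∧ 1 + y ≠ 0 := by
  rw [← mul_ne_zero_iff, E.one_sub_mul_one_add h]
  refine mul_ne_zero (pow_ne_zero 2 hx) fun k => E.a_ne_d ?_
  have e := E.one_sub_mul_one_add h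
  rw [k, mul_zero] at e
  linear_combination k - E.d * e

theorem Equation.x_ne_zero {E : TwistedEdwardsCurve F} (h : E.Equation x y)
    (h1 : (x, y) ≠ (0, 1)) (h2 : (x, y) ≠ (0, -1)) : x ≠ 0 := by
  rintro rfl
  have e := E.one_sub_mul_one_add h
  rw [zero_pow (_root_.two_ne_zero), zero_mul, mul_eq_zero] at e
  rcases e with e | e
  · exact h1 (by rw [sub_eq_zero.1 e])
  · exact h2 (by rw [eq_neg_of_add_eq_zero_right e])

/-- The point of the Montgomery cubic that corresponds to an affine point of the curve. -/
def montgomery (x y : F) : MontgomeryPoint F := .ofEdwards E.a E.d x y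

variable {E}

theorem montgomery_x_ne_zero (h : E.Equation x y) (hx : x ≠ 0) : (E.montgomery x y).x ≠ 0 := by
  obtain ⟨h1, h2⟩ := h.y_ne hx
  rw [montgomery, MontgomeryPoint.ofEdwards_x h2]
  exact mul_ne_zero E.s_ne_zero (div_ne_zero h2 h1)

theorem montgomery_y_ne_zero (h : E.Equation x y) (hx : x ≠ 0) : (E.montgomery x y).y ≠ 0 := by
  rw [montgomery, MontgomeryPoint.ofEdwards_y]
  exact div_ne_zero (montgomery_x_ne_zero h hx) hx

theorem montgomery_s (h : E.Equation x y) (hx : x ≠ 0) : (E.montgomery x y).s = (E.a - E.d) / 4 :=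
  MontgomeryPoint.ofEdwards_s (h.y_ne hx).1 (h.y_ne hx).2

theorem montgomery_A (h : E.Equation x y) (hx : x ≠ 0) : (E.montgomery x y).A = (E.a + E.d) / 2 :=
  MontgomeryPoint.ofEdwards_A E.two_ne_zero h hx (h.y_ne hx).1 (h.y_ne hx).2

theorem montgomery_x_add_s (h : E.Equation x y) (hx : x ≠ 0) :
    (E.montgomery x y).x + (E.montgomery x y).s ≠ 0 ∧
    (E.montgomery x y).x - (E.montgomery x y).s =
      y * ((E.montgomery x y).x + (E.montgomery x y).s) := by
  obtain ⟨h1, h2⟩ := h.y_ne hx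
  have e : (E.montgomery x y).x + (E.montgomery x y).s = (E.a - E.d) / 4 * (2 / (1 - y)) := by
    rw [montgomery_s h hx, montgomery, MontgomeryPoint.ofEdwards_x h2]; field_simp; ring
  refine ⟨?_, ?_⟩
  · rw [e]
    exact mul_ne_zero E.s_ne_zero (div_ne_zero E.two_ne_zero h1)
  · rw [e, montgomery_s h hx, montgomery, MontgomeryPoint.ofEdwards_x h2]; field_simp; ring

end Affine

section FunctionField

variable {F : Type*} [Field F] (E : TwistedEdwardsCurve F) {x y : F}

/-- The embedding of the constants into the function field. -/
noncomputable def constHom : F →+* E.FunctionField :=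
  E.toFunctionField.comp (Polynomial.C.comp Polynomial.C)

/-- The same curve, over its own function field, where it has the generic point `(xFun, yFun)`. -/
noncomputable def overFunctionField : TwistedEdwardsCurve E.FunctionField where
  a := E.const E.a
  d := E.const E.d
  two_ne_zero := by
    rw [← map_ofNat E.constHom 2]
    exact (map_ne_zero E.constHom).2 E.two_ne_zero
  a_ne_zero := (map_ne_zero E.constHom).2 E.a_ne_zero
  d_ne_zero := (map_ne_zero E.constHom).2 E.d_ne_zero
  a_ne_d := fun h => E.a_ne_d (E.constHom.injective h)

theorem equation_xFun_yFun : E.overFunctionField.Equation E.xFun E.yFun := by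
  have h : E.toFunctionField E.polynomial = 0 := by
    rw [toFunctionField, RingHom.comp_apply, AdjoinRoot.mk_self, map_zero]
  simp only [polynomial, map_sub, map_add, map_mul, map_pow, map_one] at h
  simp only [Equation, overFunctionField, const, xFun, yFun]
  linear_combination h

/-- The point of the Montgomery cubic that corresponds to the generic point `(xFun, yFun)`. -/
noncomputable def genericPoint : MontgomeryPoint E.FunctionField :=
  E.overFunctionField.montgomery E.xFun E.yFun

variable {E}

theorem xFun_ne_zero (h : E.Equation x y) (hx : x ≠ 0) : E.xFun ≠ 0 := fun h0 =>
  hx (hasValue_xFun.eq h (h0 ▸ (E.values x y).zero_mem))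

/-- The recursion that defines `ψ` at odd indices, for `ψ (2 k + 1)` with `k = m + 2`. -/
theorem psi_odd (m : ℕ) : E.psi (2 * (m + 2) + 1) =
    E.psi (m + 4) * E.psi (m + 2) ^ 3 - E.psi (m + 1) * E.psi (m + 3) ^ 3 := by
  rw [show 2 * (m + 2) + 1 = 2 * m + 5 by ring, psi, dif_pos (by omega),
    show (2 * m + 5) / 2 = m + 2 by omega]
  rfl

/-- The recursion that defines `ψ` at even indices, for `ψ (2 k)` with `k = m + 3`. -/
theorem psi_even (m : ℕ) : E.psi (2 * (m + 3)) = E.psi (m + 3) / E.psi 2 *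
    (E.psi (m + 5) * E.psi (m + 2) ^ 2 - E.psi (m + 1) * E.psi (m + 4) ^ 2) := by
  conv_lhs => rw [show 2 * (m + 3) = 2 * m + 1 + 5 by ring, psi, dif_neg (by omega),
    show (2 * m + 1 + 5) / 2 = m + 3 by omega]
  rfl

/-- The functions `ψ n` are the division polynomials of the Montgomery cubic. -/
theorem psi_eq (hF : E.xFun ≠ 0) (n : ℕ) : E.psi n = E.genericPoint.psi n := by
  have hE := E.equation_xFun_yFun
  obtain ⟨hy, hy'⟩ := hE.y_ne hF
  have h2 := E.overFunctionField.two_ne_zero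
  have h4 := E.overFunctionField.four_ne_zero
  have ex : E.genericPoint.x = (E.const E.a - E.const E.d) / 4 * ((1 + E.yFun) / (1 - E.yFun)) :=
    MontgomeryPoint.ofEdwards_x hy'
  have ey : E.genericPoint.y = E.genericPoint.x / E.xFun := MontgomeryPoint.ofEdwards_y
  have es : E.genericPoint.s = (E.const E.a - E.const E.d) / 4 := montgomery_s hE hF
  have eA : E.genericPoint.A = (E.const E.a + E.const E.d) / 2 := montgomery_A hE hF
  have h0 : 2 * E.genericPoint.y ≠ 0 := mul_ne_zero h2 (montgomery_y_ne_zero hE hF)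
  have e2 : E.psi 2 = 2 * E.genericPoint.y := by
    rw [psi, ey, ex, show (4 : E.FunctionField) = 2 * 2 by norm_num]; field_simp
  induction n using normEDSRec with
  | zero => simp [psi]
  | one => simp [psi]
  | two => rw [e2, Nat.cast_ofNat, MontgomeryPoint.psi_two]
  | three =>
    rw [Nat.cast_ofNat, MontgomeryPoint.psi_three, MontgomeryPoint.psiThree, ex, es, eA, psi]
    field_simp
    ring
  | four =>
    rw [Nat.cast_ofNat, MontgomeryPoint.psi_four, MontgomeryPoint.psiFour, ey, ex, es, eA, psi]
    field_simp
    ring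
  | even m i1 i2 i3 i4 i5 =>
    have h := E.genericPoint.psi_even (m + 3 : ℕ)
    rw [psi_even, e2, i1, i2, i3, i4, i5]
    push_cast at h ⊢
    rw [show (m + 3 + 2 : ℤ) = m + 5 by ring, show (m + 3 - 1 : ℤ) = m + 2 by ring,
      show (m + 3 - 2 : ℤ) = m + 1 by ring, show (m + 3 + 1 : ℤ) = m + 4 by ring] at h
    have hy0 := right_ne_zero_of_mul h0
    rw [← mul_left_inj' h0, h]
    field_simp
  | odd m i1 i2 i3 i4 =>
    have h := E.genericPoint.psi_odd (m + 2 : ℕ)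
    rw [psi_odd, i1, i2, i3, i4]
    push_cast at h ⊢
    rw [h, show (m + 2 + 2 : ℤ) = m + 4 by ring, show (m + 2 - 1 : ℤ) = m + 1 by ring,
      show (m + 2 + 1 : ℤ) = m + 3 by ring]

theorem genericPoint_s_ne_zero (hF : E.xFun ≠ 0) : E.genericPoint.s ≠ 0 := by
  rw [genericPoint, montgomery_s E.equation_xFun_yFun hF]
  exact E.overFunctionField.s_ne_zero

/-- Up to the factor `s`, the function `φ n` is the numerator of the abscissa of `[n]` of the generic
point. -/
theorem phi_eq (hF : E.xFun ≠ 0) {n : ℕ} (hn : 1 ≤ n) :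
    E.phi n = E.genericPoint.phi n / E.genericPoint.s := by
  have hE := E.equation_xFun_yFun
  obtain ⟨hy, hy'⟩ := hE.y_ne hF
  have h4 := E.overFunctionField.four_ne_zero
  have hs := genericPoint_s_ne_zero hF
  have es : E.const E.a - E.const E.d = 4 * E.genericPoint.s := by
    rw [show E.genericPoint.s = (E.const E.a - E.const E.d) / 4 from montgomery_s hE hF]
    field_simp
  have ex : E.genericPoint.x = E.genericPoint.s * ((1 + E.yFun) / (1 - E.yFun)) := by
    rw [show E.genericPoint.s = (E.const E.a - E.const E.d) / 4 from montgomery_s hE hF]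
    exact MontgomeryPoint.ofEdwards_x hy'
  obtain ⟨m, rfl⟩ : ∃ m, n = m + 1 := ⟨n - 1, by omega⟩
  rw [phi, psi_eq hF, psi_eq hF, psi_eq hF, es, MontgomeryPoint.phi, ex]
  push_cast
  rw [show (m + 1 - 1 : ℤ) = m by ring]
  field_simp

/-- Up to the factor `s`, the function `ω n` is the numerator of the ordinate of `[n]` of the generic
point. -/
theorem omega_eq (hF : E.xFun ≠ 0) {n : ℕ} (hn : E.genericPoint.psi n ≠ 0) :
    E.omega n = E.genericPoint.kappa n / (2 * E.genericPoint.s) := by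
  have hE := E.equation_xFun_yFun
  have h4 := E.overFunctionField.four_ne_zero
  have h2 := E.overFunctionField.two_ne_zero
  have hs := genericPoint_s_ne_zero hF
  have es : E.const E.a - E.const E.d = 2 * 2 * E.genericPoint.s := by
    rw [show E.genericPoint.s = (E.const E.a - E.const E.d) / 4 from montgomery_s hE hF]
    field_simp; norm_num
  rw [omega, psi_eq hF, psi_eq hF, es, Nat.cast_mul, Nat.cast_ofNat,
    ← MontgomeryPoint.psi_mul_kappa]
  field_simp

/-- The parameters of the generic point, together with their values at `(x, y)`. The two projections
from `values` map this point to the generic point and to the one that corresponds to `(x, y)`. -/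
noncomputable def valuesPoint (h : E.Equation x y) (hx : x ≠ 0) :
    MontgomeryPoint (E.values x y) where
  u := ⟨(E.genericPoint.u, (E.montgomery x y).u),
    HasValue.div h ((E.values x y).add_mem (E.values x y).one_mem
      (show (E.yFun, y) ∈ E.values x y from hasValue_yFun))
      ((E.values x y).sub_mem (E.values x y).one_mem
        (show (E.yFun, y) ∈ E.values x y from hasValue_yFun)) (h.y_ne hx).1⟩
  r := ⟨(E.genericPoint.r, (E.montgomery x y).r),
    HasValue.mul (HasValue.div h ((E.values x y).sub_mem
        (show (E.const E.a, E.a) ∈ E.values x y from hasValue_const _)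
        (show (E.const E.d, E.d) ∈ E.values x y from hasValue_const _))
        (ofNat_mem (E.values x y) 4) E.four_ne_zero)
      (HasValue.div h ((E.values x y).sub_mem (E.values x y).one_mem
        (show (E.yFun, y) ∈ E.values x y from hasValue_yFun))
        ((E.values x y).add_mem (E.values x y).one_mem
        (show (E.yFun, y) ∈ E.values x y from hasValue_yFun)) (h.y_ne hx).2)⟩
  t := ⟨(E.genericPoint.t, (E.montgomery x y).t),
    HasValue.div h (E.values x y).one_mem hasValue_xFun hx⟩

end FunctionField

end TwistedEdwardsCurve

/-! ### The multiples of a point on the Edwards curve -/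

namespace TwistedEdwardsCurve

section Regularity

variable {F : Type*} [Field F] {E : TwistedEdwardsCurve F} {x y : F}

/-- The value of a division polynomial of the generic point is the division polynomial of the value.
Both are projections of the division polynomial of `valuesPoint`, which commutes with ring
homomorphisms. The following lemmas hold for the same reason. -/
theorem hasValue_psi (h : E.Equation x y) (hx : x ≠ 0) (n : ℤ) :
    E.HasValue (E.genericPoint.psi n) x y (OnePoint.some ((E.montgomery x y).psi n)) := by
  have h1 := (valuesPoint h hx).map_psi ((RingHom.fst _ _).comp (E.values x y).subtype) n
  have h2 := (valuesPoint h hx).map_psi ((RingHom.snd _ _).comp (E.values x y).subtype) n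
  exact h1 ▸ h2 ▸ ((valuesPoint h hx).psi n).2

theorem hasValue_phi (h : E.Equation x y) (hx : x ≠ 0) (n : ℤ) :
    E.HasValue (E.genericPoint.phi n) x y (OnePoint.some ((E.montgomery x y).phi n)) := by
  have h1 := (valuesPoint h hx).map_phi ((RingHom.fst _ _).comp (E.values x y).subtype) n
  have h2 := (valuesPoint h hx).map_phi ((RingHom.snd _ _).comp (E.values x y).subtype) n
  exact h1 ▸ h2 ▸ ((valuesPoint h hx).phi n).2

theorem hasValue_kappa (h : E.Equation x y) (hx : x ≠ 0) (n : ℤ) :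
    E.HasValue (E.genericPoint.kappa n) x y (OnePoint.some ((E.montgomery x y).kappa n)) := by
  have h1 := (valuesPoint h hx).map_kappa ((RingHom.fst _ _).comp (E.values x y).subtype) n
  have h2 := (valuesPoint h hx).map_kappa ((RingHom.snd _ _).comp (E.values x y).subtype) n
  exact h1 ▸ h2 ▸ ((valuesPoint h hx).kappa n).2

theorem hasValue_s (h : E.Equation x y) (hx : x ≠ 0) :
    E.HasValue E.genericPoint.s x y (OnePoint.some (E.montgomery x y).s) := by
  have h1 := (valuesPoint h hx).map_s ((RingHom.fst _ _).comp (E.values x y).subtype)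
  have h2 := (valuesPoint h hx).map_s ((RingHom.snd _ _).comp (E.values x y).subtype)
  exact h1 ▸ h2 ▸ (valuesPoint h hx).s.2

theorem hasValue_xNum (h : E.Equation x y) (hx : x ≠ 0) (n : ℤ) (i : Bool) :
    E.HasValue (E.genericPoint.xNum n i) x y (OnePoint.some ((E.montgomery x y).xNum n i)) := by
  have h1 := (valuesPoint h hx).map_xNum ((RingHom.fst _ _).comp (E.values x y).subtype) n i
  have h2 := (valuesPoint h hx).map_xNum ((RingHom.snd _ _).comp (E.values x y).subtype) n i
  exact h1 ▸ h2 ▸ ((valuesPoint h hx).xNum n i).2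

theorem hasValue_xDen (h : E.Equation x y) (hx : x ≠ 0) (n : ℤ) (i : Bool) :
    E.HasValue (E.genericPoint.xDen n i) x y (OnePoint.some ((E.montgomery x y).xDen n i)) := by
  have h1 := (valuesPoint h hx).map_xDen ((RingHom.fst _ _).comp (E.values x y).subtype) n i
  have h2 := (valuesPoint h hx).map_xDen ((RingHom.snd _ _).comp (E.values x y).subtype) n i
  exact h1 ▸ h2 ▸ ((valuesPoint h hx).xDen n i).2

theorem hasValue_yNum (h : E.Equation x y) (hx : x ≠ 0) (n : ℤ) :
    E.HasValue (E.genericPoint.yNum n) x y (OnePoint.some ((E.montgomery x y).yNum n)) := by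
  have h1 := (valuesPoint h hx).map_yNum ((RingHom.fst _ _).comp (E.values x y).subtype) n
  have h2 := (valuesPoint h hx).map_yNum ((RingHom.snd _ _).comp (E.values x y).subtype) n
  exact h1 ▸ h2 ▸ ((valuesPoint h hx).yNum n).2

theorem hasValue_yDen (h : E.Equation x y) (hx : x ≠ 0) (n : ℤ) :
    E.HasValue (E.genericPoint.yDen n) x y (OnePoint.some ((E.montgomery x y).yDen n)) := by
  have h1 := (valuesPoint h hx).map_yDen ((RingHom.fst _ _).comp (E.values x y).subtype) n
  have h2 := (valuesPoint h hx).map_yDen ((RingHom.snd _ _).comp (E.values x y).subtype) n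
  exact h1 ▸ h2 ▸ ((valuesPoint h hx).yDen n).2

end Regularity

section NonVanishing

variable {F : Type*} [Field F] (E : TwistedEdwardsCurve F) {x y : F}

/-- The Montgomery cubic of a twisted Edwards curve is nonsingular. -/
theorem cubic_discriminant : ((E.a + E.d) / 2) ^ 2 - 4 * ((E.a - E.d) / 4) ^ 2 ≠ 0 := by
  have h2 := E.two_ne_zero
  have : ((E.a + E.d) / 2) ^ 2 - 4 * ((E.a - E.d) / 4) ^ 2 = E.a * E.d := by
    rw [show (4 : F) = 2 * 2 by norm_num]; field_simp; ring
  rw [this]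
  exact mul_ne_zero E.a_ne_zero E.d_ne_zero

/-- A nonzero polynomial in the Montgomery abscissa is nonzero at some affine point of the Edwards
curve. -/
theorem exists_eval_montgomery_ne_zero [IsAlgClosed F] {g : Polynomial F} (hg : g ≠ 0) :
    ∃ x y, E.Equation x y ∧ x ≠ 0 ∧ g.eval (E.montgomery x y).x ≠ 0 := by
  have h2 := E.two_ne_zero
  obtain ⟨p, es, eA, hpx, hpy, hps, hp⟩ :=
    MontgomeryPoint.exists_eval_ne_zero h2 E.s_ne_zero (A := (E.a + E.d) / 2) hg
  have hs : p.s ≠ 0 := es ▸ E.s_ne_zero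
  have ea : E.a = p.A + 2 * p.s := by
    rw [es, eA, show (4 : F) = 2 * 2 by norm_num]; field_simp; ring
  have ed : E.d = p.A - 2 * p.s := by
    rw [es, eA, show (4 : F) = 2 * 2 by norm_num]; field_simp; ring
  have h : E.Equation (p.x / p.y) ((p.x - p.s) / (p.x + p.s)) := by
    rw [Equation, ea, ed]
    field_simp
    linear_combination (-4 * p.s * p.x) * p.equation
  have hx : p.x / p.y ≠ 0 := div_ne_zero hpx hpy
  refine ⟨_, _, h, hx, ?_⟩
  obtain ⟨h1, h1'⟩ := h.y_ne hx
  suffices e : (E.montgomery (p.x / p.y) ((p.x - p.s) / (p.x + p.s))).x = p.x by rwa [e]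
  rw [montgomery, MontgomeryPoint.ofEdwards_x h1', ← es,
    show 1 - (p.x - p.s) / (p.x + p.s) = 2 * p.s / (p.x + p.s) by field_simp; ring]
  field_simp
  ring

variable [IsAlgClosed F]

theorem genericPoint_psi_ne_zero {n : ℕ} (hn : n ≠ 0) : E.genericPoint.psi n ≠ 0 := by
  obtain ⟨x, y, h, hx, hg⟩ := E.exists_eval_montgomery_ne_zero
    (MontgomeryPoint.pre_ne_zero E.two_ne_zero E.s_ne_zero E.cubic_discriminant hn)
  intro h0
  have e := (hasValue_psi h hx n).eq h (c' := 0) (by rw [h0]; exact (E.values x y).zero_mem)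
  rw [MontgomeryPoint.psi_eq_eval, montgomery_s h hx, montgomery_A h hx] at e
  refine mul_ne_zero hg ?_ e
  split_ifs
  · exact mul_ne_zero E.two_ne_zero (montgomery_y_ne_zero h hx)
  · exact one_ne_zero

theorem genericPoint_kappa_ne_zero {n : ℕ} (hn : n ≠ 0) : E.genericPoint.kappa n ≠ 0 := by
  intro h
  apply E.genericPoint_psi_ne_zero (n := 2 * n) (by omega)
  rw [Nat.cast_mul, Nat.cast_ofNat, ← MontgomeryPoint.psi_mul_kappa, h, mul_zero]

theorem genericPoint_yDen_ne_zero {n : ℕ} (hn : n ≠ 0) : E.genericPoint.yDen n ≠ 0 := by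
  obtain ⟨x, y, h, hx, hg⟩ := E.exists_eval_montgomery_ne_zero
    (MontgomeryPoint.yDen_polynomial_ne_zero (A := (E.a + E.d) / 2) (s := (E.a - E.d) / 4) hn)
  intro h0
  have e := (hasValue_yDen h hx n).eq h (c' := 0) (by rw [h0]; exact (E.values x y).zero_mem)
  rw [MontgomeryPoint.yDen, MontgomeryPoint.phi_eq_eval, MontgomeryPoint.psi_sq_eq_eval,
    montgomery_s h hx, montgomery_A h hx] at e
  exact hg (by simpa only [Polynomial.eval_add, Polynomial.eval_mul, Polynomial.eval_C] using e)

end NonVanishing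

section Multiples

variable {F : Type*} [Field F] {E : TwistedEdwardsCurve F} {x y : F}

/-- `(yNum n : yDen n)` is a point of the projective line. -/
theorem yNum_ne_zero_or (h : E.Equation x y) (hx : x ≠ 0) (n : ℕ) :
    (E.montgomery x y).yNum n ≠ 0 ∨ (E.montgomery x y).yDen n ≠ 0 := by
  have h2 := E.two_ne_zero
  have hs : (E.montgomery x y).s ≠ 0 := montgomery_s h hx ▸ E.s_ne_zero
  by_contra! hc
  obtain ⟨c1, c2⟩ := hc
  rw [MontgomeryPoint.yNum] at c1
  rw [MontgomeryPoint.yDen] at c2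
  have hφ : (E.montgomery x y).phi n = 0 := mul_left_cancel₀ h2 (by linear_combination c1 + c2)
  refine MontgomeryPoint.phi_ne_zero_of_psi (mul_ne_zero h2 (montgomery_y_ne_zero h hx)) ?_ hφ
  rw [hφ, zero_add, mul_eq_zero] at c2
  exact pow_eq_zero_iff (_root_.two_ne_zero) |>.1 (c2.resolve_left hs)

/-- At least one of the two pairs `(xNum n : xDen n)` is a point of the projective line. -/
theorem exists_xNum_ne_zero_or (h : E.Equation x y) (hx : x ≠ 0) (n : ℕ) :
    ∃ i, (E.montgomery x y).xNum n i ≠ 0 ∨ (E.montgomery x y).xDen n i ≠ 0 := by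
  have h2 := E.two_ne_zero
  have hs : (E.montgomery x y).s ≠ 0 := montgomery_s h hx ▸ E.s_ne_zero
  have hφψ := MontgomeryPoint.phi_ne_zero_of_psi (n := n)
    (mul_ne_zero h2 (montgomery_y_ne_zero h hx))
  by_cases hψ : (E.montgomery x y).psi n = 0
  · have := hφψ hψ
    exact ⟨false, Or.inr (by simp [MontgomeryPoint.xDen, *])⟩
  · by_cases hφ : (E.montgomery x y).phi n = 0
    · exact ⟨false, Or.inr (by simp [MontgomeryPoint.xDen, *])⟩
    · exact ⟨true, Or.inl (by simp [MontgomeryPoint.xNum, *])⟩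

/-- The point `P` of the completion has the coordinates that are expected of `[n] (x, y)`. Both pairs
`(xNum : xDen)` are compared with the first coordinate, as either may be `(0, 0)`. -/
def IsMultiple (x y : F) (n : ℕ) (P : OnePoint F × OnePoint F) : Prop :=
  (∀ i, num P.1 * (E.montgomery x y).xDen n i = den P.1 * (E.montgomery x y).xNum n i) ∧
    num P.2 * (E.montgomery x y).yDen n = den P.2 * (E.montgomery x y).yNum n

/-- Homogeneous coordinates of a projective point are proportional to those of its canonical
representative. -/
theorem exists_eq_mul {z : OnePoint F} {s t : F} (h : s ≠ 0 ∨ t ≠ 0) (hz : num z * t = den z * s) :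
    ∃ e, e ≠ 0 ∧ s = e * num z ∧ t = e * den z := by
  rw [eq_ratio h hz]
  exact exists_eq_mul_ratio h

theorem ratio_mul_eq {s t s' t' : F} (h : s ≠ 0 ∨ t ≠ 0) (e : s' * t = t' * s) :
    num (ratio s t) * t' = den (ratio s t) * s' := by
  obtain ⟨l, hl, h1, h2⟩ := exists_eq_mul_ratio h
  refine mul_left_cancel₀ hl ?_
  linear_combination -e - t' * h1 + s' * h2

theorem add_eq_of_first_rule {P : OnePoint F × OnePoint F}
    (hf : (num P.1 * y * den P.2 + x * num P.2 * den P.1 ≠ 0 ∨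
        den P.1 * den P.2 + E.d * num P.1 * x * num P.2 * y ≠ 0) ∧
      (num P.2 * y * den P.1 - E.a * num P.1 * x * den P.2 ≠ 0 ∨
        den P.1 * den P.2 - E.d * num P.1 * x * num P.2 * y ≠ 0)) :
    E.add P (OnePoint.some x, OnePoint.some y) =
      (ratio (num P.1 * y * den P.2 + x * num P.2 * den P.1)
        (den P.1 * den P.2 + E.d * num P.1 * x * num P.2 * y),
      ratio (num P.2 * y * den P.1 - E.a * num P.1 * x * den P.2)
        (den P.1 * den P.2 - E.d * num P.1 * x * num P.2 * y)) := by
  rw [add, if_pos (by simpa only [num_some, den_some, mul_one] using hf)]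
  simp only [num_some, den_some, mul_one]

theorem add_eq_of_second_rule {P : OnePoint F × OnePoint F}
    (hf : ¬((num P.1 * y * den P.2 + x * num P.2 * den P.1 ≠ 0 ∨
        den P.1 * den P.2 + E.d * num P.1 * x * num P.2 * y ≠ 0) ∧
      (num P.2 * y * den P.1 - E.a * num P.1 * x * den P.2 ≠ 0 ∨
        den P.1 * den P.2 - E.d * num P.1 * x * num P.2 * y ≠ 0))) :
    E.add P (OnePoint.some x, OnePoint.some y) =
      (ratio (num P.1 * num P.2 + x * y * den P.1 * den P.2)
        (E.a * num P.1 * x * den P.2 + num P.2 * y * den P.1),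
      ratio (num P.1 * num P.2 - x * y * den P.1 * den P.2)
        (num P.1 * y * den P.2 - x * num P.2 * den P.1)) := by
  rw [add, if_neg (by simpa only [num_some, den_some, mul_one] using hf)]
  simp only [num_some, den_some, mul_one]

/-- Adding `(x, y)` increases the multiple by one. By `MontgomeryPoint.isSum`, both rules give the
expected coordinates wherever they are defined. -/
theorem IsMultiple.add (h : E.Equation x y) (hx : x ≠ 0) {n : ℕ} {P : OnePoint F × OnePoint F}
    (hP : IsMultiple (E := E) x y n P) :
    IsMultiple (E := E) x y (n + 1) (E.add P (OnePoint.some x, OnePoint.some y)) := by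
  obtain ⟨hP1, hP2⟩ := hP
  have h2 := E.two_ne_zero
  have hs : (E.montgomery x y).s ≠ 0 := montgomery_s h hx ▸ E.s_ne_zero
  have hy := montgomery_y_ne_zero h hx
  obtain ⟨hX, eX⟩ := montgomery_x_add_s h hx
  have ex : (E.montgomery x y).x = x * (E.montgomery x y).y := by
    rw [montgomery, MontgomeryPoint.ofEdwards_y]; field_simp
  have ea : (E.montgomery x y).A + 2 * (E.montgomery x y).s = E.a := by
    rw [montgomery_s h hx, montgomery_A h hx, show (4 : F) = 2 * 2 by norm_num]; field_simp; ring
  have ed : (E.montgomery x y).A - 2 * (E.montgomery x y).s = E.d := by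
    rw [montgomery_s h hx, montgomery_A h hx, show (4 : F) = 2 * 2 by norm_num]; field_simp; ring
  obtain ⟨i, hi⟩ := exists_xNum_ne_zero_or h hx n
  obtain ⟨e, he, e1, e2⟩ := exists_eq_mul hi (hP1 i)
  obtain ⟨c, hc, c1, c2⟩ := exists_eq_mul (yNum_ne_zero_or h hx n) hP2
  -- The point `P` lies on the completion.
  have hcurve : E.a * num P.1 ^ 2 * den P.2 ^ 2 + num P.2 ^ 2 * den P.1 ^ 2 =
      den P.1 ^ 2 * den P.2 ^ 2 + E.d * num P.1 ^ 2 * num P.2 ^ 2 := by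
    have hκ := (E.montgomery x y).kappa_sq n
    refine mul_left_cancel₀ (mul_ne_zero (pow_ne_zero 2 he) (pow_ne_zero 2 hc)) ?_
    have : E.a * (E.montgomery x y).xNum n i ^ 2 * (E.montgomery x y).yDen n ^ 2 +
        (E.montgomery x y).yNum n ^ 2 * (E.montgomery x y).xDen n i ^ 2 =
        (E.montgomery x y).xDen n i ^ 2 * (E.montgomery x y).yDen n ^ 2 +
        E.d * (E.montgomery x y).xNum n i ^ 2 * (E.montgomery x y).yNum n ^ 2 := by
      rw [← ea, ← ed]
      generalize E.montgomery x y = p at *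
      cases i <;> simp only [MontgomeryPoint.xNum, MontgomeryPoint.xDen, MontgomeryPoint.yNum,
        MontgomeryPoint.yDen]
      · linear_combination (4 * p.s * p.psi n ^ 2 *
          (p.phi n ^ 2 + p.A * p.phi n * p.psi n ^ 2 + p.s ^ 2 * p.psi n ^ 4)) * hκ
      · linear_combination (-4 * p.s * p.phi n * p.psi n ^ 2) * hκ
    rw [e1, e2, c1, c2] at this
    linear_combination this
  have hsum : ∀ j, _ := fun j => (E.montgomery x y).isSum n i j
  rw [e1, e2, c1, c2] at hsum
  replace hsum := fun j => (hsum j).of_scale he hc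
  -- Each relation in `hsum` carries the factor `p.y * (p.x + p.s)`, the common denominator of the
  -- Edwards coordinates `x = p.x / p.y` and `y = (p.x - p.s) / (p.x + p.s)`.
  simp only [MontgomeryPoint.IsSum, ea, ed, eX] at hsum
  simp only [ex] at hsum
  rw [ex] at hX
  have hyX := mul_ne_zero hy hX
  have hcomplete := E.second_rule_defined hx h P hcurve
  have hf_or := em ((num P.1 * y * den P.2 + x * num P.2 * den P.1 ≠ 0 ∨
        den P.1 * den P.2 + E.d * num P.1 * x * num P.2 * y ≠ 0) ∧
      (num P.2 * y * den P.1 - E.a * num P.1 * x * den P.2 ≠ 0 ∨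
        den P.1 * den P.2 - E.d * num P.1 * x * num P.2 * y ≠ 0))
  rcases hf_or with hf | hf
  · rw [add_eq_of_first_rule hf]
    refine ⟨fun j => ratio_mul_eq hf.1 (mul_left_cancel₀ hyX ?_),
      ratio_mul_eq hf.2 (mul_left_cancel₀ hyX ?_)⟩
    · linear_combination (hsum j).1
    · linear_combination (hsum true).2.1
  · have hg := hcomplete hf
    rw [add_eq_of_second_rule hf]
    refine ⟨fun j => ratio_mul_eq hg.1 (mul_left_cancel₀ hyX ?_),
      ratio_mul_eq hg.2 (mul_left_cancel₀ hyX ?_)⟩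
    · linear_combination (hsum j).2.2.1
    · linear_combination (hsum true).2.2.2

theorem isMultiple_multiple (h : E.Equation x y) (hx : x ≠ 0) (n : ℕ) :
    IsMultiple (E := E) x y n (E.multiple n (OnePoint.some x, OnePoint.some y)) := by
  induction n with
  | zero =>
    refine ⟨fun i => ?_, ?_⟩
    · cases i <;> simp [multiple, MontgomeryPoint.xNum]
    · simp [multiple, MontgomeryPoint.yNum, MontgomeryPoint.yDen]
  | succ n ih => exact ih.add h hx

end Multiples

end TwistedEdwardsCurve

theorem theorem5p1 {k : Type*} [Field k] (hk3 : (3 : k) ≠ 0) (E₀ : TwistedEdwardsCurve k)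
    (E : TwistedEdwardsCurve (AlgebraicClosure k))
    (hE : E = E₀.baseChange (AlgebraicClosure k))
    (x y : AlgebraicClosure k) (hxy : E.Equation x y)
    (h1 : (x, y) ≠ (0, 1)) (h2 : (x, y) ≠ (0, -1)) (n : ℕ) (hn : 1 ≤ n) :
    E.IsRegularAt (E.psi n) x y ∧ E.IsRegularAt (E.phi n) x y ∧ E.IsRegularAt (E.omega n) x y ∧
    E.omega n ≠ 0 ∧ E.phi n + E.psi n ^ 2 ≠ 0 ∧
    ∃ u v : OnePoint (AlgebraicClosure k),
      E.multiple n (OnePoint.some x, OnePoint.some y) = (u, v) ∧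
      E.HasValue (E.phi n * E.psi n / E.omega n) x y u ∧
      E.HasValue ((E.phi n - E.psi n ^ 2) / (E.phi n + E.psi n ^ 2)) x y v := by
  have hx : x ≠ 0 := hxy.x_ne_zero h1 h2
  have hn0 : n ≠ 0 := by omega
  have hF := TwistedEdwardsCurve.xFun_ne_zero hxy hx
  have hψ := E.genericPoint_psi_ne_zero hn0
  have hκ := E.genericPoint_kappa_ne_zero hn0
  have hD := E.genericPoint_yDen_ne_zero hn0
  have hs := TwistedEdwardsCurve.genericPoint_s_ne_zero hF
  have hs' : (E.montgomery x y).s ≠ 0 := TwistedEdwardsCurve.montgomery_s hxy hx ▸ E.s_ne_zero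
  have h2' := E.overFunctionField.two_ne_zero
  have vs := TwistedEdwardsCurve.hasValue_s hxy hx
  have vψ := TwistedEdwardsCurve.hasValue_psi hxy hx n
  have vφ := TwistedEdwardsCurve.hasValue_phi hxy hx n
  have vκ := TwistedEdwardsCurve.hasValue_kappa hxy hx n
  have eκ := E.genericPoint.kappa_sq n
  obtain ⟨hP1, hP2⟩ := TwistedEdwardsCurve.isMultiple_multiple hxy hx n
  rw [TwistedEdwardsCurve.psi_eq hF, TwistedEdwardsCurve.phi_eq hF hn,
    TwistedEdwardsCurve.omega_eq hF hψ]
  refine ⟨⟨_, vψ⟩, ⟨_, vφ.div hxy vs hs'⟩,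
    ⟨_, vκ.div hxy (TwistedEdwardsCurve.HasValue.mul (ofNat_mem (E.values x y) 2) vs)
      (mul_ne_zero E.two_ne_zero hs')⟩,
    div_ne_zero hκ (mul_ne_zero h2' hs), ?_, _, _, rfl, ?_, ?_⟩
  · have e : E.genericPoint.phi n / E.genericPoint.s + E.genericPoint.psi n ^ 2 =
        E.genericPoint.yDen n / E.genericPoint.s := by
      rw [MontgomeryPoint.yDen]; field_simp
    rw [e]
    exact div_ne_zero hD hs
  · obtain ⟨i, hi⟩ := TwistedEdwardsCurve.exists_xNum_ne_zero_or hxy hx n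
    rw [TwistedEdwardsCurve.eq_ratio hi (hP1 i)]
    refine TwistedEdwardsCurve.HasValue.of_mul_eq (TwistedEdwardsCurve.hasValue_xDen hxy hx n i)
      (TwistedEdwardsCurve.hasValue_xNum hxy hx n i) ?_ hi
    cases i <;> simp only [MontgomeryPoint.xNum, MontgomeryPoint.xDen]
    · field_simp
      linear_combination -eκ
    · field_simp
  · have hi := TwistedEdwardsCurve.yNum_ne_zero_or hxy hx n
    rw [TwistedEdwardsCurve.eq_ratio hi hP2]
    refine TwistedEdwardsCurve.HasValue.of_mul_eq (TwistedEdwardsCurve.hasValue_yDen hxy hx n)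
      (TwistedEdwardsCurve.hasValue_yNum hxy hx n) ?_ hi
    have e : E.genericPoint.phi n / E.genericPoint.s + E.genericPoint.psi n ^ 2 =
        E.genericPoint.yDen n / E.genericPoint.s := by
      rw [MontgomeryPoint.yDen]; field_simp
    have e' : E.genericPoint.phi n / E.genericPoint.s - E.genericPoint.psi n ^ 2 =
        E.genericPoint.yNum n / E.genericPoint.s := by
      rw [MontgomeryPoint.yNum]; field_simp
    rw [e, e']
    field_simp
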